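/- All graphs are finite and simple. For a graph $H$ let $\lambda_{\max}(H)$ and $\lambda_{\min}(H)$ be the largest and smallest eigenvalue of its adjacency matrix. A graph $H$ with at least one edge is *Hoffman colorable* if $\chi(H)=1-\lambda_{\max}(H)/\lambda_{\min}(H)$, and *non-trivially Hoffman colorable* if moreover it is neither bipartite nor a regular complete multipartite graph $K_{m,\dots,m}$. For $m\ge 0$ let $CP(m)$ be the complete multipartite graph with $m$ classes of size $2$. For a graph $G$ with vertices $v_1,\dots,v_n$ and integers $a_1,\dots,a_n\ge 0$, the *generalized line graph* $L(G;a_1,\dots,a_n)$ is obtained from the disjoint union of the line graph $L(G)$ and of $CP(a_1),\dots,CP(a_n)$ by joining, for every $i$, each vertex of $CP(a_i)$ to each edge of $G$ (as a vertex of $L(G)$) that is incident with $v_i$. **Theorem.** If $GL=L(G;a_1,\dots,a_n)$ is a connected, non-trivially Hoffman colorable generalized line graph with $\lambda_{\min}(GL)>-2$, then $a_1=\dots=a_n=0$ (so $GL$ is the line graph of $G$). In particular, let $S$ be the graph on $\{1,\dots,6\}$ with edges $14,15,24,26,35,36,45,46,56$ (a triangle $456$ together with, for each of its edges, one further vertex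 adjacent to exactly the two ends of that edge). Then $S$ is, up to isomorphism, the unique connected non-trivially Hoffman colorable generalized line graph with $\lambda_{\min}>-2$: a graph $H$ is a connected, non-trivially Hoffman colorable generalized line graph with $\lambda_{\min}(H)>-2$ if and only if $H\cong S$. -/

import Mathlib

namespace HoffmanGL

universe u

/-- The set of adjacency eigenvalues of a finite graph. -/
noncomputable def adjSpectrum {V : Type u} [Finite V] (G : SimpleGraph V) : Set ℝ :=
  letI := Fintype.ofFinite V
  letI := Classical.decEq V
  letI := Classical.decRel G.Adj
  spectrum ℝ (G.adjMatrix ℝ)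

/-- The largest adjacency eigenvalue. -/
noncomputable def lambdaMax {V : Type u} [Finite V] (G : SimpleGraph V) : ℝ :=
  sSup (adjSpectrum G)

/-- The smallest adjacency eigenvalue. -/
noncomputable def lambdaMin {V : Type u} [Finite V] (G : SimpleGraph V) : ℝ :=
  sInf (adjSpectrum G)

/-- The Hoffman bound `1 - λ_max / λ_min`, meaningful for graphs with at least one edge. -/
noncomputable def hoffmanBound {V : Type u} [Finite V] (G : SimpleGraph V) : ℝ :=
  1 - lambdaMax G / lambdaMin G

/-- A finite graph with at least one edge is Hoffman colorable if its chromatic number equals the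
Hoffman bound. (The chromatic number of a finite graph is finite, so `toNat` loses nothing.) -/
def IsHoffmanColorable {V : Type u} [Finite V] (G : SimpleGraph V) : Prop :=
  G ≠ ⊥ ∧ (G.chromaticNumber.toNat : ℝ) = hoffmanBound G

/-- `G` is a regular complete multipartite graph `K_{m,…,m}`. -/
def IsRegularCompleteMultipartite {V : Type u} (G : SimpleGraph V) : Prop :=
  ∃ r m : ℕ, Nonempty (G ≃g SimpleGraph.completeEquipartiteGraph r m)

/-- Hoffman colorable, but neither bipartite nor regular complete multipartite. -/
def IsNontriviallyHoffmanColorable {V : Type u} [Finite V] (G : SimpleGraph V) : Prop :=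
  IsHoffmanColorable G ∧ ¬ G.IsBipartite ∧ ¬ IsRegularCompleteMultipartite G

/-- The cocktail party graph `CP(m)`: complete multipartite with `m` classes of size 2. -/
abbrev cocktailParty (m : ℕ) : SimpleGraph (Fin m × Fin 2) :=
  SimpleGraph.completeEquipartiteGraph m 2

/-- Vertices of the generalized line graph: the edges of `G`, and for each vertex `v` of `G` the
vertices of a copy of `CP(a v)`. -/
abbrev GLVertex {V : Type u} (G : SimpleGraph V) (a : V → ℕ) : Type u :=
  G.edgeSet ⊕ (Σ v : V, Fin (a v) × Fin 2)

/-- The generalized line graph `L(G; a)`: the disjoint union of the line graph `L(G)` and of the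
cocktail party graphs `CP(a v)`, where moreover each vertex of the copy of `CP(a v)` is joined to
each edge of `G` incident to `v`. -/
def generalizedLineGraph {V : Type u} (G : SimpleGraph V) (a : V → ℕ) :
    SimpleGraph (GLVertex G a) where
  Adj x y := match x, y with
    | .inl e, .inl f => G.lineGraph.Adj e f
    | .inl e, .inr p => p.1 ∈ (e : Sym2 V)
    | .inr p, .inl e => p.1 ∈ (e : Sym2 V)
    | .inr p, .inr q => ∃ (v : V) (s t : Fin (a v) × Fin 2),
        p = ⟨v, s⟩ ∧ q = ⟨v, t⟩ ∧ (cocktailParty (a v)).Adj s t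
  symm := ⟨by
    rintro (e | p) (f | q) h
    · exact SimpleGraph.Adj.symm h
    · exact h
    · exact h
    · obtain ⟨v, s, t, hp, hq, hst⟩ := h
      exact ⟨v, t, s, hq, hp, hst.symm⟩⟩
  loopless := ⟨by
    rintro (e | p) h
    · exact SimpleGraph.irrefl _ h
    · obtain ⟨v, s, t, hp, hq, hst⟩ := h
      have hs : s = t := by
        have := hp.symm.trans hq
        simpa using this
      subst hs
      exact SimpleGraph.irrefl _ hst⟩

/-- `H` is (isomorphic to) a generalized line graph `L(G; a_1, …, a_n)` of a finite graph `G`. -/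
def IsGeneralizedLineGraph {W : Type u} (H : SimpleGraph W) : Prop :=
  ∃ (n : ℕ) (G : SimpleGraph (Fin n)) (a : Fin n → ℕ),
    Nonempty (H ≃g generalizedLineGraph G a)

/-- A triangle `3, 4, 5`, and for each of its edges one further vertex
(`0`, `1`, `2` respectively for `34`, `35`, `45`) adjacent to exactly the two ends of that edge. -/
def sunGraph : SimpleGraph (Fin 6) :=
  SimpleGraph.fromEdgeSet {s(0, 3), s(0, 4), s(1, 3), s(1, 5), s(2, 4), s(2, 5),
    s(3, 4), s(3, 5), s(4, 5)}

end HoffmanGL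

namespace HoffmanGL

universe u v

open Matrix

/-! ### Rayleigh bounds for adjacency matrices and the Perron vector -/

section Spectrum

variable {V : Type u} [Fintype V] [DecidableEq V] (H : SimpleGraph V) [DecidableRel H.Adj]

/-! Equality in Hoffman's bound makes every optimal colouring rigid: with the Perron vector as
weights, the neighbours of `p` of any colour other than that of `p` have total weight `θ` times the
weight of `p`, where `θ = -λ_min` (`nonempty_weightedColoring`). Non-bipartiteness gives `k ≥ 3`
colours. Excluding complete graphs, the case `K_{1,…,1}`, gives `θ ≠ 1`.

The second ingredient is the root representation `A + 2 = NᵀN`, where `N` is the incidence matrix of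
the root graph with petals. If `λ_min > -2`, then `N` is injective, and comparing columns with
nonzero rows gives `|E| + ∑ a ≤` the number of vertices with `deg + a > 0`
(`card_edgeFinset_add_sum_le`).

Rigidity forces `deg + a ≥ 3` at every vertex carrying a petal and at every neighbour of a leaf, and
forbids two leaves at one vertex. Discharging against the count (`eq_zero_and_degree_le_three`)
leaves no petals, maximum degree at most 3, and a leaf at each vertex of degree 3.

On such a root graph the weights are computed along edges (`degree_eq_three_of_adj`): every non-leaf
neighbour of a vertex of degree 3 again has degree 3, and `θ² = θ + 1`. Hence the root graph
contains either a net, which is closed under adjacency and whose line graph is the sun, or a path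
with five edges (`exists_net_or_path`). The path would force `θ ≥ 12/7`, which exceeds the golden
ratio. The converse is a direct computation of the spectrum of the sun. -/

theorem adjSpectrum_eq : adjSpectrum H = spectrum ℝ (H.adjMatrix ℝ) := by
  unfold adjSpectrum
  congr!

theorem mem_adjSpectrum_iff {μ : ℝ} :
    μ ∈ adjSpectrum H ↔ ∃ y : V → ℝ, y ≠ 0 ∧ H.adjMatrix ℝ *ᵥ y = μ • y := by
  rw [adjSpectrum_eq, ← Matrix.spectrum_toLin', ← Module.End.hasEigenvalue_iff_mem_spectrum]
  constructor
  · intro h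
    obtain ⟨y, hy⟩ := h.exists_hasEigenvector
    exact ⟨y, hy.2, by simpa using hy.apply_eq_smul⟩
  · rintro ⟨y, hy, h⟩
    exact Module.End.hasEigenvalue_of_hasEigenvector (x := y)
      ⟨Module.End.mem_eigenspace_iff.2 (by simpa using h), hy⟩

theorem isHermitian_adjMatrix {V : Type u} (H : SimpleGraph V) [DecidableRel H.Adj] : (H.adjMatrix ℝ).IsHermitian := by
  rw [Matrix.IsHermitian, Matrix.conjTranspose_eq_transpose_of_trivial, SimpleGraph.transpose_adjMatrix]

theorem adjSpectrum_finite : (adjSpectrum H).Finite := by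
  rw [adjSpectrum_eq]; exact Matrix.finite_real_spectrum

theorem adjSpectrum_nonempty [Nonempty V] : (adjSpectrum H).Nonempty := by
  rw [adjSpectrum_eq]
  exact ⟨_, (isHermitian_adjMatrix H).eigenvalues_mem_spectrum_real (Classical.arbitrary V)⟩

theorem lambdaMax_mem [Nonempty V] : lambdaMax H ∈ adjSpectrum H :=
  (adjSpectrum_nonempty H).csSup_mem (adjSpectrum_finite H)

theorem posSemidef_of_spectrum_nonneg {B : Matrix V V ℝ} (hB : B.IsHermitian)
    (h : ∀ μ ∈ spectrum ℝ B, 0 ≤ μ) : B.PosSemidef :=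
  hB.posSemidef_iff_eigenvalues_nonneg.2 fun i => h _ (hB.eigenvalues_mem_spectrum_real i)

theorem posSemidef_adjMatrix_sub_lambdaMin :
    (H.adjMatrix ℝ - lambdaMin H • (1 : Matrix V V ℝ)).PosSemidef := by
  refine posSemidef_of_spectrum_nonneg ?_ fun μ hμ => ?_
  · exact (isHermitian_adjMatrix H).sub (by simp [Matrix.IsHermitian])
  · rw [← Algebra.algebraMap_eq_smul_one, ← spectrum.sub_singleton_eq, ← adjSpectrum_eq] at hμ
    obtain ⟨ν, hν, _, rfl, rfl⟩ := hμ
    exact sub_nonneg.2 (csInf_le (adjSpectrum_finite H).bddBelow hν)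

theorem posSemidef_lambdaMax_sub_adjMatrix :
    (lambdaMax H • (1 : Matrix V V ℝ) - H.adjMatrix ℝ).PosSemidef := by
  refine posSemidef_of_spectrum_nonneg ?_ fun μ hμ => ?_
  · exact IsHermitian.sub (by simp [Matrix.IsHermitian]) (isHermitian_adjMatrix H)
  · rw [← Algebra.algebraMap_eq_smul_one, ← spectrum.singleton_sub_eq, ← adjSpectrum_eq] at hμ
    obtain ⟨_, rfl, ν, hν, rfl⟩ := hμ
    exact sub_nonneg.2 (le_csSup (adjSpectrum_finite H).bddAbove hν)

theorem lambdaMin_mul_dotProduct_le (y : V → ℝ) :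
    lambdaMin H * (y ⬝ᵥ y) ≤ y ⬝ᵥ H.adjMatrix ℝ *ᵥ y := by
  have := (posSemidef_adjMatrix_sub_lambdaMin H).dotProduct_mulVec_nonneg y
  rw [sub_mulVec, dotProduct_sub, smul_mulVec, one_mulVec, dotProduct_smul] at this
  simpa using this

theorem le_lambdaMax_mul_dotProduct (y : V → ℝ) :
    y ⬝ᵥ H.adjMatrix ℝ *ᵥ y ≤ lambdaMax H * (y ⬝ᵥ y) := by
  have := (posSemidef_lambdaMax_sub_adjMatrix H).dotProduct_mulVec_nonneg y
  rw [sub_mulVec, dotProduct_sub, smul_mulVec, one_mulVec, dotProduct_smul] at this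
  simpa using this

theorem mulVec_eq_of_dotProduct_eq_lambdaMin {y : V → ℝ}
    (h : y ⬝ᵥ H.adjMatrix ℝ *ᵥ y = lambdaMin H * (y ⬝ᵥ y)) :
    H.adjMatrix ℝ *ᵥ y = lambdaMin H • y := by
  have := ((posSemidef_adjMatrix_sub_lambdaMin H).dotProduct_mulVec_zero_iff y).1 (by
    rw [sub_mulVec, dotProduct_sub, smul_mulVec, one_mulVec, dotProduct_smul]
    simp [h])
  rwa [sub_mulVec, smul_mulVec, one_mulVec, sub_eq_zero] at this

theorem mulVec_eq_of_dotProduct_eq_lambdaMax {y : V → ℝ}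
    (h : y ⬝ᵥ H.adjMatrix ℝ *ᵥ y = lambdaMax H * (y ⬝ᵥ y)) :
    H.adjMatrix ℝ *ᵥ y = lambdaMax H • y := by
  have := ((posSemidef_lambdaMax_sub_adjMatrix H).dotProduct_mulVec_zero_iff y).1 (by
    rw [sub_mulVec, dotProduct_sub, smul_mulVec, one_mulVec, dotProduct_smul]
    simp [h])
  rw [sub_mulVec, smul_mulVec, one_mulVec, sub_eq_zero] at this
  exact this.symm

theorem adjMatrix_mulVec_eq_sum {V : Type u} [Fintype V] (H : SimpleGraph V)
    [DecidableRel H.Adj] (y : V → ℝ) (p : V) :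
    (H.adjMatrix ℝ *ᵥ y) p = ∑ q, if H.Adj p q then y q else 0 := by
  simp [Matrix.mulVec, dotProduct, SimpleGraph.adjMatrix_apply]

/-- A Perron vector. -/
theorem exists_pos_eigenvector (hc : H.Connected) :
    ∃ x : V → ℝ, (∀ p, 0 < x p) ∧ H.adjMatrix ℝ *ᵥ x = lambdaMax H • x := by
  have := hc.nonempty
  obtain ⟨y, hy0, hy⟩ := (mem_adjSpectrum_iff H).1 (lambdaMax_mem H)
  have habs : (fun p => |y p|) ⬝ᵥ (fun p => |y p|) = y ⬝ᵥ y := by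
    simp [dotProduct]
  have hx : H.adjMatrix ℝ *ᵥ (fun p => |y p|) = lambdaMax H • (fun p => |y p|) := by
    -- Taking absolute values keeps the norm and does not decrease the quadratic form, so `|y|` also
    -- attains the maximal Rayleigh quotient.
    refine mulVec_eq_of_dotProduct_eq_lambdaMax H (le_antisymm (le_lambdaMax_mul_dotProduct H _) ?_)
    rw [habs, ← smul_eq_mul, ← dotProduct_smul, ← hy]
    simp only [dotProduct, adjMatrix_mulVec_eq_sum]
    refine Finset.sum_le_sum fun p _ => ?_
    rw [Finset.mul_sum, Finset.mul_sum]
    refine Finset.sum_le_sum fun q _ => ?_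
    split_ifs
    · rw [← abs_mul]; exact le_abs_self _
    · simp
  refine ⟨_, fun p => ?_, hx⟩
  by_contra hp
  have hp0 : y p = 0 := by simpa using hp
  -- A zero of the nonnegative eigenvector spreads to all neighbours, hence by connectedness
  -- everywhere.
  have step : ∀ q r, H.Adj q r → y q = 0 → y r = 0 := by
    intro q r hqr hq
    have h1 := congrFun hx q
    rw [adjMatrix_mulVec_eq_sum] at h1
    simp only [Pi.smul_apply, hq, abs_zero, smul_zero] at h1
    have h2 := (Finset.sum_eq_zero_iff_of_nonneg (fun r _ => by split_ifs <;> positivity)).1 h1 r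
      (Finset.mem_univ r)
    simpa [hqr] using h2
  have all : ∀ q, H.Reachable p q → y q = 0 := by
    rintro q ⟨w⟩
    induction w with
    | nil => exact hp0
    | cons h _ ih => exact ih (by simpa using step _ _ h hp0) (step _ _ h hp0)
  exact hy0 (funext fun q => all q (hc.preconnected p q))

end Spectrum

end HoffmanGL

/-! ### Equality in Hoffman's bound -/

namespace HoffmanGL

universe u v

open Matrix

/-- A proper colouring together with positive vertex weights such that, for every vertex `p` and
every colour `j` other than its own, the weights of the neighbours of `p` of colour `j` add up to
`θ` times the weight of `p`. -/
structure WeightedColoring {V : Type u} [Fintype V] (H : SimpleGraph V) (k : ℕ) (θ : ℝ) where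
  color : H.Coloring (Fin k)
  weight : V → ℝ
  weight_pos : ∀ p, 0 < weight p
  sum_weight : ∀ p j, color p ≠ j →
    open Classical in ∑ q, (if H.Adj p q ∧ color q = j then weight q else 0) = θ * weight p

section Hoffman

variable {V : Type u} [Fintype V] [DecidableEq V] (H : SimpleGraph V) [DecidableRel H.Adj]

theorem lambdaMin_neg (h : H ≠ ⊥) : lambdaMin H < 0 := by
  obtain ⟨p, q, hpq⟩ := SimpleGraph.ne_bot_iff_exists_adj.1 h
  have h1 := lambdaMin_mul_dotProduct_le H (Pi.single p 1 - Pi.single q 1)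
  have hne := hpq.ne
  simp [Matrix.mulVec_sub, SimpleGraph.adjMatrix_apply, hpq, hpq.symm, hne, hne.symm] at h1
  linarith

theorem lambdaMax_eq (h : IsHoffmanColorable H) :
    lambdaMax H = -((H.chromaticNumber.toNat : ℝ) - 1) * lambdaMin H := by
  have h0 := lambdaMin_neg H h.1
  have h2 := h.2
  unfold hoffmanBound at h2
  have : lambdaMax H / lambdaMin H * lambdaMin H = lambdaMax H := div_mul_cancel₀ _ h0.ne
  rw [← this, h2]; ring

theorem colorable_chromaticNumber_toNat {V : Type u} [Finite V] (H : SimpleGraph V) :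
    H.Colorable H.chromaticNumber.toNat := by
  have := Fintype.ofFinite V
  exact H.colorable_chromaticNumber H.colorable_of_fintype

theorem three_le_chromaticNumber {V : Type u} [Finite V] {H : SimpleGraph V}
    (h : ¬ H.IsBipartite) : 3 ≤ H.chromaticNumber.toNat := by
  by_contra hlt
  exact h ((colorable_chromaticNumber_toNat H).mono (by omega))

/-- Let `z i` be the restriction of `x` to colour class `i`. The form of `A - λ_min` is nonnegative
at each `x - k • z i`. Since `z i ⬝ᵥ A *ᵥ z i = 0` and `λ_max = -(k - 1) λ_min`, its values sum to
zero over the colours, so each of them vanishes. -/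
theorem mulVec_sub_smul_of_isHoffmanColorable (h : IsHoffmanColorable H) {x : V → ℝ}
    (hx : H.adjMatrix ℝ *ᵥ x = lambdaMax H • x)
    (C : H.Coloring (Fin H.chromaticNumber.toNat)) (i : Fin H.chromaticNumber.toNat) :
    H.adjMatrix ℝ *ᵥ (x - (H.chromaticNumber.toNat : ℝ) • fun p => if C p = i then x p else 0) =
      lambdaMin H • (x - (H.chromaticNumber.toNat : ℝ) • fun p => if C p = i then x p else 0) := by
  have hmax := lambdaMax_eq H h
  generalize H.chromaticNumber.toNat = k at *
  set z : Fin k → V → ℝ := fun i p => if C p = i then x p else 0 with hz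
  set A := H.adjMatrix ℝ with hA
  have hsum : ∑ i, z i = x := by
    ext p; simp [hz]
  have hzx : ∀ i, x ⬝ᵥ z i = z i ⬝ᵥ z i := fun i => by
    simp only [hz, dotProduct]
    refine Finset.sum_congr rfl fun p _ => ?_
    split_ifs <;> simp
  have hzA : ∀ i, z i ⬝ᵥ A *ᵥ z i = 0 := fun i => by
    simp only [dotProduct, hA, adjMatrix_mulVec_eq_sum, Finset.mul_sum]
    refine Finset.sum_eq_zero fun p _ => Finset.sum_eq_zero fun q _ => ?_
    by_cases hpq : H.Adj p q
    · have := C.valid hpq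
      by_cases hp : C p = i
      · have hq : C q ≠ i := fun hq => this (hp.trans hq.symm)
        simp [hz, hq]
      · simp [hz, hp]
    · simp [hpq]
  have hxA : ∀ y, x ⬝ᵥ A *ᵥ y = lambdaMax H * (x ⬝ᵥ y) := fun y => by
    rw [dotProduct_mulVec, ← mulVec_transpose, hA, SimpleGraph.transpose_adjMatrix, ← hA, hx,
      smul_dotProduct, smul_eq_mul]
  have hAx : ∀ y, y ⬝ᵥ A *ᵥ x = lambdaMax H * (x ⬝ᵥ y) := fun y => by
    rw [hx, dotProduct_smul, smul_eq_mul, dotProduct_comm]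
  have hsum' : ∑ i, x ⬝ᵥ z i = x ⬝ᵥ x := by
    rw [← dotProduct_sum, hsum]
  have hq : ∀ i, (x - (k : ℝ) • z i) ⬝ᵥ A *ᵥ (x - (k : ℝ) • z i) -
      lambdaMin H * ((x - (k : ℝ) • z i) ⬝ᵥ (x - (k : ℝ) • z i)) =
      (lambdaMax H - lambdaMin H) * (x ⬝ᵥ x) +
      (-2 * k * lambdaMax H + 2 * k * lambdaMin H - k ^ 2 * lambdaMin H) * (x ⬝ᵥ z i) := fun i => by
    simp only [mulVec_sub, mulVec_smul, dotProduct_sub, sub_dotProduct, smul_dotProduct,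
      dotProduct_smul, smul_eq_mul, hzA, hxA, hAx, dotProduct_comm (z i) x, ← hzx]
    ring
  have hnn : ∀ i, 0 ≤ (x - (k : ℝ) • z i) ⬝ᵥ A *ᵥ (x - (k : ℝ) • z i) -
      lambdaMin H * ((x - (k : ℝ) • z i) ⬝ᵥ (x - (k : ℝ) • z i)) := fun i =>
    sub_nonneg.2 (lambdaMin_mul_dotProduct_le H _)
  have hzero : ∑ i, ((x - (k : ℝ) • z i) ⬝ᵥ A *ᵥ (x - (k : ℝ) • z i) -
      lambdaMin H * ((x - (k : ℝ) • z i) ⬝ᵥ (x - (k : ℝ) • z i))) = 0 := by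
    simp only [hq]
    rw [Finset.sum_add_distrib, ← Finset.mul_sum, ← Finset.mul_sum, hsum', hmax]
    simp
    ring
  have := (Finset.sum_eq_zero_iff_of_nonneg fun i _ => hnn i).1 hzero i (Finset.mem_univ i)
  exact mulVec_eq_of_dotProduct_eq_lambdaMin H (sub_eq_zero.1 this)

/-- At a vertex `p` not of colour `j`, the eigenvector equation for `x - k • z j` reads `λ_max x p -
k S = λ_min x p`, where `S` is the sought sum; Hoffman equality turns this into `S = -λ_min x p`. -/
theorem nonempty_weightedColoring (hc : H.Connected) (h : IsHoffmanColorable H) :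
    Nonempty (WeightedColoring H H.chromaticNumber.toNat (-lambdaMin H)) := by
  obtain ⟨x, hpos, hx⟩ := exists_pos_eigenvector H hc
  obtain ⟨C⟩ := colorable_chromaticNumber_toNat H
  refine ⟨⟨C, x, hpos, fun p j hpj => ?_⟩⟩
  have h1 := congrFun (mulVec_sub_smul_of_isHoffmanColorable H h hx C j) p
  rw [mulVec_sub, mulVec_smul, hx, Pi.sub_apply, Pi.smul_apply, Pi.smul_apply,
    adjMatrix_mulVec_eq_sum, Pi.smul_apply, Pi.sub_apply, Pi.smul_apply, if_neg hpj,
    lambdaMax_eq H h] at h1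
  have hk : (0 : ℝ) < H.chromaticNumber.toNat := by
    have := (Fin.pos (C p)); exact_mod_cast this
  have hs : ∑ q, (if H.Adj p q then if C q = j then x q else 0 else 0) = -lambdaMin H * x p := by
    simp only [smul_eq_mul] at h1
    apply mul_left_cancel₀ hk.ne'
    linarith
  rw [← hs]
  refine Finset.sum_congr rfl fun q _ => ?_
  by_cases h1 : H.Adj p q <;> by_cases h2 : C q = j <;> simp [h1, h2]

end Hoffman

namespace WeightedColoring

variable {V : Type u} [Fintype V] {H : SimpleGraph V} {k : ℕ} {θ : ℝ}
  (c : WeightedColoring H k θ)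

theorem exists_adj (hθ : 0 < θ) {p : V} {j : Fin k} (h : c.color p ≠ j) :
    ∃ q, H.Adj p q ∧ c.color q = j := by
  classical
  by_contra! hn
  have := c.sum_weight p j h
  rw [Finset.sum_eq_zero fun q _ => if_neg fun hq => hn q hq.1 hq.2] at this
  have := mul_pos hθ (c.weight_pos p)
  linarith

theorem mul_weight_eq {p q : V} (hpq : H.Adj p q)
    (h : ∀ r, H.Adj p r → c.color r = c.color q → r = q) :
    θ * c.weight p = c.weight q := by
  classical
  rw [← c.sum_weight p _ (c.color.valid hpq), Finset.sum_eq_single q]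
  · simp [hpq]
  · intro r _ hr
    exact if_neg fun h' => hr (h r h'.1 h'.2)
  · simp

theorem mul_weight_eq_add {p q r : V} (hpq : H.Adj p q) (hpr : H.Adj p r) (hqr : q ≠ r)
    (hcol : c.color r = c.color q)
    (h : ∀ s, H.Adj p s → c.color s = c.color q → s = q ∨ s = r) :
    θ * c.weight p = c.weight q + c.weight r := by
  classical
  rw [← c.sum_weight p _ (c.color.valid hpq), ← Finset.sum_subset (Finset.subset_univ {q, r})]
  · simp [Finset.sum_pair hqr, hpq, hpr, hcol]
  · intro s _ hs
    refine if_neg fun h' => hs ?_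
    simpa using h s h'.1 h'.2

/-- Two vertices with the same neighbours have the same colour. -/
theorem color_eq_of_forall_adj_iff (hθ : 0 < θ) {p q : V} (h : ∀ r, H.Adj p r ↔ H.Adj q r) :
    c.color p = c.color q := by
  by_contra hne
  obtain ⟨r, hr, hc⟩ := c.exists_adj hθ hne
  exact c.color.valid ((h r).1 hr) hc.symm

end WeightedColoring

/-! ### The case of smallest eigenvalue at least -1 -/

section Complete

variable {V : Type u} [Fintype V] [DecidableEq V] (H : SimpleGraph V) [DecidableRel H.Adj]

theorem adj_trans_of_neg_one_le_lambdaMin (h : -1 ≤ lambdaMin H) {p q r : V} (hpq : H.Adj p q)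
    (hqr : H.Adj q r) (hpr : p ≠ r) : H.Adj p r := by
  by_contra hn
  -- On an induced path `p q r` the vector `(1, -1, 1)` has Rayleigh quotient `-4/3`.
  have h1 := lambdaMin_mul_dotProduct_le H (Pi.single p 1 - Pi.single q 1 + Pi.single r 1)
  have hn' : ¬ H.Adj r p := fun h => hn h.symm
  simp [Matrix.mulVec_sub, Matrix.mulVec_add, SimpleGraph.adjMatrix_apply, hpq, hpq.symm, hpq.ne,
    hpq.ne.symm, hqr, hqr.symm, hqr.ne, hqr.ne.symm, hn, hn', hpr, hpr.symm] at h1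
  linarith

theorem isRegularCompleteMultipartite_of_neg_one_le_lambdaMin (hc : H.Connected)
    (h : -1 ≤ lambdaMin H) : IsRegularCompleteMultipartite H := by
  have all : ∀ p q, H.Reachable p q → p = q ∨ H.Adj p q := by
    rintro p q ⟨w⟩
    induction w with
    | nil => exact Or.inl rfl
    | @cons a b d hab _ ih =>
      by_cases had : a = d
      · exact Or.inl had
      · rcases ih with rfl | hbd
        · exact Or.inr hab
        · exact Or.inr (adj_trans_of_neg_one_le_lambdaMin H h hab hbd had)
  -- A complete graph is regular complete multipartite with classes of size 1.
  refine ⟨Fintype.card V, 1, ⟨⟨(Fintype.equivFin V).trans (Equiv.prodUnique _ _).symm, ?_⟩⟩⟩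
  intro p q
  simp only [SimpleGraph.completeEquipartiteGraph_adj]
  constructor
  · intro hne
    refine (all p q (hc.preconnected p q)).resolve_left ?_
    rintro rfl
    exact hne rfl
  · intro hpq
    simpa using hpq.ne

end Complete

end HoffmanGL

namespace HoffmanGL

universe u v

open Matrix Finset

/-! ### Root representation and the rank count -/

section Counting

set_option linter.unusedSectionVars false

variable {V : Type u} {G : SimpleGraph V} {a : V → ℕ}

/-- Incidence of vertices of the generalized line graph with vertices of the root graph. -/
def Incident : GLVertex G a → V → Prop
  | .inl e, v => v ∈ (e : Sym2 V)
  | .inr p, v => p.1 = v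

/-- The petal to which a vertex of one of the cocktail party graphs belongs. -/
def petal (p : Σ v : V, Fin (a v) × Fin 2) : Σ v : V, Fin (a v) := ⟨p.1, p.2.1⟩

theorem adj_inl_inl {e f : G.edgeSet} :
    (generalizedLineGraph G a).Adj (.inl e) (.inl f) ↔
      e ≠ f ∧ ∃ v, v ∈ (e : Sym2 V) ∧ v ∈ (f : Sym2 V) := by
  change G.lineGraph.Adj e f ↔ _
  rw [SimpleGraph.lineGraph_adj_iff_exists]

theorem adj_inl_inr {e : G.edgeSet} {p : Σ v : V, Fin (a v) × Fin 2} :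
    (generalizedLineGraph G a).Adj (.inl e) (.inr p) ↔ p.1 ∈ (e : Sym2 V) := Iff.rfl

theorem adj_inr_inl {e : G.edgeSet} {p : Σ v : V, Fin (a v) × Fin 2} :
    (generalizedLineGraph G a).Adj (.inr p) (.inl e) ↔ p.1 ∈ (e : Sym2 V) := Iff.rfl

theorem adj_inr_inr {p q : Σ v : V, Fin (a v) × Fin 2} :
    (generalizedLineGraph G a).Adj (.inr p) (.inr q) ↔ p.1 = q.1 ∧ petal p ≠ petal q := by
  change (∃ (v : V) (s t : Fin (a v) × Fin 2),
        p = ⟨v, s⟩ ∧ q = ⟨v, t⟩ ∧ (cocktailParty (a v)).Adj s t) ↔ _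
  constructor
  · rintro ⟨v, s, t, rfl, rfl, h⟩
    refine ⟨rfl, fun he => h ?_⟩
    simpa [petal] using he
  · obtain ⟨v, s⟩ := p
    obtain ⟨w, t⟩ := q
    rintro ⟨h, hne⟩
    obtain rfl : v = w := h
    refine ⟨v, s, t, rfl, rfl, fun he => hne ?_⟩
    simp [petal]
    exact he

theorem exists_incident_of_adj {p q : GLVertex G a} (h : (generalizedLineGraph G a).Adj p q) :
    ∃ v, Incident p v ∧ Incident q v := by
  rcases p with e | p <;> rcases q with f | q
  · exact (adj_inl_inl.1 h).2
  · exact ⟨q.1, h, rfl⟩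
  · exact ⟨p.1, rfl, h⟩
  · exact ⟨p.1, rfl, (adj_inr_inr.1 h).1.symm⟩

theorem adj_inl_of_incident {e : G.edgeSet} {q : GLVertex G a} {v : V} (he : v ∈ (e : Sym2 V))
    (hq : Incident q v) (hne : Sum.inl e ≠ q) :
    (generalizedLineGraph G a).Adj (.inl e) q := by
  rcases q with f | q
  · exact adj_inl_inl.2 ⟨fun h => hne (by rw [h]), v, he, hq⟩
  · obtain rfl : q.1 = v := hq
    exact he

variable [Fintype V] [DecidableEq V] [DecidableRel G.Adj]

open Classical in
/-- The signed incidence matrix of the root multigraph (with petals) of a generalized line graph. -/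
noncomputable def rootMatrix (G : SimpleGraph V) (a : V → ℕ) :
    Matrix (V ⊕ Σ v : V, Fin (a v)) (GLVertex G a) ℝ := Matrix.of fun r p => match r, p with
  | .inl v, p => if Incident p v then 1 else 0
  | .inr _, .inl _ => 0
  | .inr s, .inr p => if s = petal p then (if p.2.2 = 0 then 1 else -1) else 0

open Classical in
theorem rootMatrix_inl (v : V) (p : GLVertex G a) :
    rootMatrix G a (.inl v) p = if Incident p v then 1 else 0 := by
  rcases p with e | p <;> rfl

theorem rootMatrix_inr_inl (s : Σ v : V, Fin (a v)) (e : G.edgeSet) :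
    rootMatrix G a (.inr s) (.inl e) = 0 := rfl

open Classical in
theorem rootMatrix_inr_inr (s : Σ v : V, Fin (a v)) (p : Σ v : V, Fin (a v) × Fin 2) :
    rootMatrix G a (.inr s) (.inr p) = if s = petal p then (if p.2.2 = 0 then 1 else -1) else 0 :=
  rfl

open Classical in
theorem sum_ite_incident_inl {u w : V} (he : s(u, w) ∈ G.edgeSet) (g : V → ℝ) :
    ∑ v, (if Incident (.inl ⟨s(u, w), he⟩ : GLVertex G a) v then 1 else 0) * g v = g u + g w := by
  rw [← Finset.sum_subset (Finset.subset_univ {u, w})]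
  · simp [Finset.sum_pair (G.ne_of_adj he), Incident]
  · intro v _ hv
    have : ¬ Incident (.inl ⟨s(u, w), he⟩ : GLVertex G a) v := by simpa [Incident] using hv
    simp [this]

open Classical in
theorem sum_ite_incident_inr (p : Σ v : V, Fin (a v) × Fin 2) (g : V → ℝ) :
    ∑ v, (if Incident (.inr p : GLVertex G a) v then 1 else 0) * g v = g p.1 := by
  rw [Finset.sum_eq_single p.1]
  · simp [Incident]
  · intro v _ hv
    have : ¬ Incident (.inr p : GLVertex G a) v := fun h => hv h.symm
    simp [this]
  · simp

open Classical in
-- Columns are root vectors with two nonzero entries. The opposite signs in a petal's own row make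
-- its two columns orthogonal, matching their non-adjacency in the cocktail party graph.
theorem transpose_rootMatrix_mul_rootMatrix :
    (rootMatrix G a)ᵀ * rootMatrix G a = (generalizedLineGraph G a).adjMatrix ℝ + 2 := by
  ext p q
  rw [Matrix.mul_apply, Fintype.sum_sum_type, Matrix.add_apply, SimpleGraph.adjMatrix_apply,
    Matrix.ofNat_apply]
  simp only [Matrix.transpose_apply, rootMatrix_inl]
  rcases p with e | p <;> rcases q with f | q
  · obtain ⟨e, he⟩ := e
    induction e with | h u w
    have huw : u ≠ w := G.ne_of_adj he
    have h3 : u ∈ (f : Sym2 V) → w ∈ (f : Sym2 V) → (⟨s(u, w), he⟩ : G.edgeSet) = f := fun h1 h2 =>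
      Subtype.ext (((Sym2.mem_and_mem_iff huw).1 ⟨h1, h2⟩).symm)
    rw [sum_ite_incident_inl]
    simp only [adj_inl_inl, rootMatrix_inr_inl, mul_zero, Finset.sum_const_zero,
      add_zero, Sum.inl.injEq, Sym2.mem_iff, exists_eq_left, or_and_right,
      exists_or, Incident]
    by_cases hef : (⟨s(u, w), he⟩ : G.edgeSet) = f
    · subst hef
      simp; norm_num
    · by_cases hu : u ∈ (f : Sym2 V) <;> by_cases hw : w ∈ (f : Sym2 V)
      · exact absurd (h3 hu hw) hef
      all_goals simp [hef, hu, hw]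
  · rw [Finset.sum_congr rfl fun v _ => mul_comm _ _, sum_ite_incident_inr]
    simp [rootMatrix_inr_inl, Incident, adj_inl_inr]
    congr
  · rw [sum_ite_incident_inr]
    simp [rootMatrix_inr_inl, Incident, adj_inr_inl]
    congr
  · rw [sum_ite_incident_inr]
    simp only [rootMatrix_inr_inr, adj_inr_inr, ite_mul, zero_mul, Finset.sum_ite_eq',
      Finset.mem_univ, if_true]
    obtain ⟨v, i, s⟩ := p
    obtain ⟨w, j, t⟩ := q
    by_cases hvw : v = w
    · subst hvw
      by_cases hij : i = j
      · subst hij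
        fin_cases s <;> fin_cases t <;> simp [petal, Incident] <;> norm_num
      · have : j ≠ i := fun h => hij h.symm
        simp [petal, Incident, hij]
    · have : w ≠ v := fun h => hvw h.symm
      simp [petal, Incident, hvw, this]

/-- A kernel vector of the root matrix would be an eigenvector for `-2`, so the number of columns,
`|E| + 2 ∑ a`, is at most the number of nonzero rows. The petal rows account for `∑ a` of them. -/
theorem card_edgeFinset_add_sum_le (h : -2 < lambdaMin (generalizedLineGraph G a)) :
    G.edgeFinset.card + ∑ v, a v ≤ #{v | 0 < G.degree v + a v} := by
  classical
  have hker : ∀ y, rootMatrix G a *ᵥ y = 0 → y = 0 := fun y hy => by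
    by_contra hy0
    have h1 : (generalizedLineGraph G a).adjMatrix ℝ *ᵥ y = (-2 : ℝ) • y := by
      have h2 : ((rootMatrix G a)ᵀ * rootMatrix G a) *ᵥ y = 0 := by
        rw [← Matrix.mulVec_mulVec, hy, Matrix.mulVec_zero]
      rw [transpose_rootMatrix_mul_rootMatrix, Matrix.add_mulVec, Matrix.ofNat_mulVec] at h2
      rw [neg_smul]
      exact eq_neg_of_add_eq_zero_left (by simpa using h2)
    have h2 := csInf_le (adjSpectrum_finite (generalizedLineGraph G a)).bddBelow
      ((mem_adjSpectrum_iff _).2 ⟨y, hy0, h1⟩)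
    exact absurd h (not_lt.2 h2)
  -- Isolated vertices without petals give zero rows, so deleting those rows preserves injectivity.
  let ι : {v // 0 < G.degree v + a v} ⊕ (Σ v : V, Fin (a v)) → V ⊕ Σ v : V, Fin (a v) :=
    Sum.map Subtype.val id
  have hinj : Function.Injective ((rootMatrix G a).submatrix ι id).mulVecLin := by
    rw [injective_iff_map_eq_zero]
    intro y hy
    refine hker y (funext ?_)
    rintro (v | s)
    · by_cases hv : 0 < G.degree v + a v
      · exact congrFun hy (Sum.inl ⟨v, hv⟩)
      · refine Finset.sum_eq_zero fun p _ => ?_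
        have : ¬ Incident p v := fun hp => by
          rcases p with ⟨e, he⟩ | ⟨w, i, s⟩
          · induction e with | h x z
            simp only [Incident, Sym2.mem_iff] at hp
            rcases hp with rfl | rfl
            · have := (G.degree_pos_iff_exists_adj v).2 ⟨z, he⟩
              omega
            · have := (G.degree_pos_iff_exists_adj v).2 ⟨x, SimpleGraph.Adj.symm he⟩
              omega
          · obtain rfl : w = v := hp
            have := i.pos
            omega
        simp [rootMatrix, this]
    · exact congrFun hy (Sum.inr s)
  have := LinearMap.finrank_le_finrank_of_injective hinj
  simp only [Module.finrank_fintype_fun_eq_card, Fintype.card_sum, Fintype.card_sigma,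
    Fintype.card_prod, Fintype.card_fin, ← Finset.sum_mul,
    ← SimpleGraph.edgeFinset_card] at this
  rw [Fintype.card_subtype] at this
  omega

end Counting

end HoffmanGL

/-! ### Pendant edges, petals and discharging -/

namespace HoffmanGL

universe u v

open Finset

theorem eq_one_of_mul_eq_of_mul_eq {θ : ℝ} (hθ : 0 < θ) {x y : ℝ} (hx : 0 < x) (h1 : θ * x = y)
    (h2 : θ * y = x) : θ = 1 := by
  have h3 : (θ - 1) * (θ + 1) = 0 := by
    apply mul_right_cancel₀ hx.ne'
    linear_combination θ * h1 + h2
  rcases mul_eq_zero.1 h3 with h | h <;> linarith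

section RootGraph

set_option linter.unusedSectionVars false

variable {V : Type u} [Fintype V] [DecidableEq V] {G : SimpleGraph V} [DecidableRel G.Adj]
  {a : V → ℕ}

/-- A discharging argument: each vertex of degree 1 passes its deficiency to its neighbour. -/
theorem eq_zero_and_degree_le_three
    (hcount : #G.edgeFinset + ∑ v, a v ≤ #{v | 0 < G.degree v + a v})
    (h1 : ∀ v, 0 < a v → 3 ≤ G.degree v + a v)
    (h2 : ∀ u v, G.Adj u v → G.degree v + a v = 1 → 3 ≤ G.degree u + a u)
    (h3 : ∀ u v w, G.Adj u v → G.Adj u w → G.degree v + a v = 1 → G.degree w + a w = 1 → v = w) :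
    (∀ v, a v = 0) ∧ (∀ v, G.degree v ≤ 3) ∧
      ∀ v, G.degree v = 3 → ∃ l, G.Adj v l ∧ G.degree l = 1 := by
  set L : Finset V := {v | G.degree v + a v = 1} with hL
  set D : Finset V := {v | 3 ≤ G.degree v + a v} with hD
  have hnbr : ∀ v : V, ∃ u, G.degree v + a v = 1 → G.Adj u v := fun v => by
    by_cases hv : G.degree v + a v = 1
    · have ha : a v = 0 := by
        by_contra ha
        have := h1 v (Nat.pos_of_ne_zero ha)
        omega
      obtain ⟨u, hu⟩ := (G.degree_pos_iff_exists_adj v).1 (by omega)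
      exact ⟨u, fun _ => hu.symm⟩
    · exact ⟨v, fun h => absurd h hv⟩
  choose f hf using hnbr
  have hmaps : L.image f ⊆ D := by
    intro u hu
    obtain ⟨v, hv, rfl⟩ := mem_image.1 hu
    have hv' : G.degree v + a v = 1 := by simpa [hL] using hv
    simpa [hD] using h2 _ _ (hf v hv') hv'
  have hcard : #(L.image f) = #L := by
    refine card_image_of_injOn fun v hv w hw hvw => ?_
    have hv' : G.degree v + a v = 1 := by simpa [hL] using hv
    have hw' : G.degree w + a w = 1 := by simpa [hL] using hw
    exact h3 _ _ _ (hf v hv') (hvw ▸ hf w hw') hv' hw'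
  have hLD : #L ≤ #D := hcard ▸ card_le_card hmaps
  -- Equality holds here exactly when `deg + a ≤ 3`. Summing gives `2 #{deg + a > 0} + #D ≤ 2 |E| +
  -- ∑ a + #L`; with `hcount` and `#L ≤ #D` this forces `∑ a = 0` and equality throughout.
  have hpt : ∀ v ∈ (univ : Finset V), 2 * (if 0 < G.degree v + a v then 1 else 0) +
      (if 3 ≤ G.degree v + a v then 1 else 0) ≤
      G.degree v + a v + (if G.degree v + a v = 1 then 1 else 0) := fun v _ => by
    split_ifs <;> omega
  have hdeg : ∑ v, (G.degree v + a v) = 2 * #G.edgeFinset + ∑ v, a v := by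
    rw [sum_add_distrib, G.sum_degrees_eq_twice_card_edges]
  have hsl : ∑ v, (2 * (if 0 < G.degree v + a v then 1 else 0) +
      (if 3 ≤ G.degree v + a v then 1 else 0)) = 2 * #{v | 0 < G.degree v + a v} + #D := by
    rw [sum_add_distrib, ← mul_sum, card_filter, card_filter]
  have hsr : ∑ v, (G.degree v + a v + (if G.degree v + a v = 1 then 1 else 0)) =
      2 * #G.edgeFinset + ∑ v, a v + #L := by
    rw [sum_add_distrib, hdeg, card_filter]
  have hle := sum_le_sum hpt
  rw [hsl, hsr] at hle
  have ha : ∀ v, a v = 0 := fun v => by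
    have h0 : ∑ v, a v = 0 := by omega
    exact sum_eq_zero_iff.1 h0 v (mem_univ v)
  have heq := (sum_eq_sum_iff_of_le hpt).1 (by rw [hsl, hsr]; omega)
  refine ⟨ha, fun v => ?_, fun v hv => ?_⟩
  · have := heq v (mem_univ v)
    split_ifs at this <;> omega
  -- Equality also gives `#L = #D`, so every vertex of degree 3 is the neighbour of a leaf.
  · have himg : L.image f = D := eq_of_subset_of_card_le hmaps (by omega)
    have hvD : v ∈ D := by
      rw [hD, mem_filter_univ]; omega
    rw [← himg] at hvD
    obtain ⟨l, hl, rfl⟩ := mem_image.1 hvD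
    have hl' : G.degree l + a l = 1 := by simpa [hL] using hl
    exact ⟨l, hf l hl', by rw [← hl', ha l, add_zero]⟩

theorem eq_inl_of_incident_of_degree_add_eq_one {u v : V} (huv : G.Adj u v)
    (hv : G.degree v + a v = 1) {q : GLVertex G a} (hq : Incident q v) :
    q = Sum.inl ⟨s(u, v), huv⟩ := by
  have hpos := (G.degree_pos_iff_exists_adj v).2 ⟨u, huv.symm⟩
  rcases q with ⟨e, he⟩ | ⟨w, i, s⟩
  · obtain ⟨w, rfl⟩ := Sym2.mem_iff_exists.1 hq
    obtain ⟨z, _, hz⟩ := SimpleGraph.degree_eq_one_iff_existsUnique_adj.1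
      (show G.degree v = 1 by omega)
    have : w = u := (hz w he).trans (hz u huv.symm).symm
    subst this
    exact congrArg Sum.inl (Subtype.ext Sym2.eq_swap)
  · obtain rfl : w = v := hq
    have := i.pos
    omega

variable {k : ℕ} {θ : ℝ} (c : WeightedColoring (generalizedLineGraph G a) k θ)

include c

/-- The two vertices of a petal are twins and share a colour, so at most one colour per edge at `v`
and one per petal at `v` can occur. -/
theorem le_degree_add_of_forall_exists_incident (hθ : 0 < θ) {v : V}
    (h : ∀ j, ∃ p : GLVertex G a, Incident p v ∧ c.color p = j) : k ≤ G.degree v + a v := by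
  classical
  let S : Finset (GLVertex G a) :=
    (univ : Finset (G.neighborSet v)).image (fun w : G.neighborSet v => Sum.inl ⟨s(v, w), w.2⟩) ∪
      (univ : Finset (Fin (a v))).image (fun i => Sum.inr ⟨v, i, 0⟩)
  have hS : #S ≤ G.degree v + a v := by
    refine (card_union_le _ _).trans (add_le_add (card_image_le.trans ?_) (card_image_le.trans ?_))
    · rw [card_univ, SimpleGraph.card_neighborSet_eq_degree]
    · simp
  have himg : S.image c.color = univ := by
    refine eq_univ_of_forall fun j => ?_
    obtain ⟨p, hp, rfl⟩ := h j
    rcases p with ⟨e, he⟩ | ⟨w, i, s⟩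
    · obtain ⟨w, rfl⟩ := Sym2.mem_iff_exists.1 hp
      exact mem_image_of_mem _ (mem_union_left _ (mem_image.2 ⟨⟨w, he⟩, mem_univ _, rfl⟩))
    · obtain rfl : w = v := hp
      have htwin : c.color (Sum.inr ⟨w, i, s⟩) = c.color (Sum.inr ⟨w, i, 0⟩) := by
        refine c.color_eq_of_forall_adj_iff hθ fun r => ?_
        rcases r with e | r
        · rfl
        · rw [adj_inr_inr, adj_inr_inr]; rfl
      rw [htwin]
      exact mem_image_of_mem _ (mem_union_right _ (mem_image.2 ⟨i, mem_univ _, rfl⟩))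
  calc k = #(S.image c.color) := by rw [himg, card_univ, Fintype.card_fin]
    _ ≤ #S := card_image_le
    _ ≤ _ := hS

theorem le_degree_add_of_pos (hθ : 0 < θ) {v : V} (hv : 0 < a v) : k ≤ G.degree v + a v := by
  refine le_degree_add_of_forall_exists_incident c hθ fun j => ?_
  let p : GLVertex G a := Sum.inr ⟨v, ⟨0, hv⟩, 0⟩
  by_cases hj : c.color p = j
  · exact ⟨p, rfl, hj⟩
  · obtain ⟨q, hpq, hq⟩ := c.exists_adj hθ hj
    obtain ⟨w, hw, hqw⟩ := exists_incident_of_adj hpq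
    obtain rfl : v = w := hw
    exact ⟨q, hqw, hq⟩

theorem le_degree_add_of_adj_leaf (hθ : 0 < θ) {u v : V} (huv : G.Adj u v)
    (hv : G.degree v + a v = 1) : k ≤ G.degree u + a u := by
  refine le_degree_add_of_forall_exists_incident c hθ fun j => ?_
  by_cases hj : c.color (Sum.inl ⟨s(u, v), huv⟩) = j
  · exact ⟨Sum.inl ⟨s(u, v), huv⟩, Sym2.mem_mk_left u v, hj⟩
  · obtain ⟨q, hpq, hq⟩ := c.exists_adj hθ hj
    obtain ⟨w, hw, hqw⟩ := exists_incident_of_adj hpq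
    rcases Sym2.mem_iff.1 hw with rfl | rfl
    · exact ⟨q, hqw, hq⟩
    · rw [eq_inl_of_incident_of_degree_add_eq_one huv hv hqw] at hpq
      exact absurd hpq (SimpleGraph.irrefl _)

/-- All neighbours of the pendant edge `uv` are incident with `u`, and the edge `uw` is adjacent to
every other one of them. So it is the only neighbour of its colour. -/
theorem mul_weight_eq_of_leaf {u v w : V} (huv : G.Adj u v)
    (huw : G.Adj u w) (hv : G.degree v + a v = 1) (hvw : v ≠ w) :
    θ * c.weight (Sum.inl ⟨s(u, v), huv⟩) = c.weight (Sum.inl ⟨s(u, w), huw⟩) := by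
  have hne : (Sum.inl ⟨s(u, v), huv⟩ : GLVertex G a) ≠ Sum.inl ⟨s(u, w), huw⟩ := by
    intro h
    exact hvw (Sym2.congr_right.1 (congrArg Subtype.val (Sum.inl.inj h)))
  refine c.mul_weight_eq (adj_inl_of_incident (Sym2.mem_mk_left u v) (Sym2.mem_mk_left u w) hne)
    fun r hr hcol => ?_
  obtain ⟨z, hz, hrz⟩ := exists_incident_of_adj hr
  rcases Sym2.mem_iff.1 hz with rfl | rfl
  · by_contra hrne
    exact c.color.valid (adj_inl_of_incident (Sym2.mem_mk_left z w) hrz (Ne.symm hrne)) hcol.symm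
  · rw [eq_inl_of_incident_of_degree_add_eq_one huv hv hrz] at hr
    exact absurd hr (SimpleGraph.irrefl _)

/-- Each of two pendant edges at `u` would weigh `θ` times the other. -/
theorem leaf_unique (hθ : 0 < θ) (hθ1 : θ ≠ 1) {u v w : V} (huv : G.Adj u v)
    (huw : G.Adj u w) (hv : G.degree v + a v = 1) (hw : G.degree w + a w = 1) : v = w := by
  by_contra hvw
  have h1 := mul_weight_eq_of_leaf c huv huw hv hvw
  have h2 := mul_weight_eq_of_leaf c huw huv hw (Ne.symm hvw)
  exact hθ1 (eq_one_of_mul_eq_of_mul_eq hθ (c.weight_pos _) h1 h2)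

end RootGraph

end HoffmanGL

/-! ### Weighted edge colourings of the root graph -/

namespace HoffmanGL

universe u v

open Finset

/-- The edge version of `WeightedColoring`: a proper edge colouring with positive edge weights such
that for every edge and every other colour `j`, the edges of colour `j` meeting it have total weight
`θ` times its weight. -/
structure EdgeWeighting {V : Type u} (G : SimpleGraph V) (k : ℕ) (θ : ℝ) where
  col : V → V → ℕ
  wt : V → V → ℝ
  col_comm : ∀ u v, col u v = col v u
  wt_comm : ∀ u v, wt u v = wt v u
  wt_pos : ∀ {u v}, G.Adj u v → 0 < wt u v
  eq_of_col_eq : ∀ {u v w}, G.Adj u v → G.Adj u w → col u v = col u w → v = w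
  exists_col : ∀ {u v j}, G.Adj u v → j < k → j ≠ col u v →
    ∃ w, (G.Adj u w ∧ col u w = j) ∨ (G.Adj v w ∧ col v w = j)
  mul_wt_eq : ∀ {u v w}, G.Adj u v → G.Adj u w → v ≠ w →
    (∀ z, G.Adj v z → col v z ≠ col u w) → θ * wt u v = wt u w
  mul_wt_eq_add : ∀ {u v w z}, G.Adj u v → G.Adj u w → v ≠ w → G.Adj v z → z ≠ u →
    col v z = col u w → θ * wt u v = wt u w + wt v z

section OfLineGraph

variable {V : Type u} {G : SimpleGraph V}

theorem lineGraph_adj_mk {u v w : V} (huv : G.Adj u v) (huw : G.Adj u w) (h : v ≠ w) :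
    G.lineGraph.Adj ⟨s(u, v), huv⟩ ⟨s(u, w), huw⟩ := by
  rw [SimpleGraph.lineGraph_adj_iff_exists]
  exact ⟨fun he => h (Sym2.congr_right.1 (congrArg Subtype.val he)), u, Sym2.mem_mk_left _ _,
    Sym2.mem_mk_left _ _⟩

theorem exists_eq_mk_of_lineGraph_adj {u v : V} (huv : G.Adj u v) {e : G.edgeSet}
    (h : G.lineGraph.Adj ⟨s(u, v), huv⟩ e) :
    (∃ w, ∃ huw : G.Adj u w, v ≠ w ∧ e = ⟨s(u, w), huw⟩) ∨
      ∃ w, ∃ hvw : G.Adj v w, u ≠ w ∧ e = ⟨s(v, w), hvw⟩ := by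
  rw [SimpleGraph.lineGraph_adj_iff_exists] at h
  obtain ⟨hne, x, hx, hxe⟩ := h
  obtain ⟨e, he⟩ := e
  obtain ⟨w, rfl⟩ := Sym2.mem_iff_exists.1 hxe
  rcases Sym2.mem_iff.1 hx with rfl | rfl
  · refine Or.inl ⟨w, he, ?_, rfl⟩
    rintro rfl
    exact hne rfl
  · refine Or.inr ⟨w, he, ?_, rfl⟩
    rintro rfl
    exact hne (Subtype.ext Sym2.eq_swap)

open Classical in
/-- A weighted colouring of the line graph, seen as an edge weighting of the root graph. -/
noncomputable def WeightedColoring.toEdgeWeighting [Fintype G.edgeSet] {k : ℕ} {θ : ℝ}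
    (c : WeightedColoring G.lineGraph k θ) (hθ : 0 < θ) : EdgeWeighting G k θ :=
  have hcol : ∀ {u v} (h : G.Adj u v), (if h : G.Adj u v then (c.color ⟨s(u, v), h⟩ : ℕ) else 0) =
    c.color ⟨s(u, v), h⟩ := fun h => dif_pos h
  have hwt : ∀ {u v} (h : G.Adj u v), (if h : G.Adj u v then c.weight ⟨s(u, v), h⟩ else 0) =
    c.weight ⟨s(u, v), h⟩ := fun h => dif_pos h
  have hsymm : ∀ {u v} (h : G.Adj u v), (⟨s(u, v), h⟩ : G.edgeSet) = ⟨s(v, u), h.symm⟩ :=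
    fun h => Subtype.ext Sym2.eq_swap
  { col := fun u v => if h : G.Adj u v then (c.color ⟨s(u, v), h⟩ : ℕ) else 0
    wt := fun u v => if h : G.Adj u v then c.weight ⟨s(u, v), h⟩ else 0
    col_comm := fun u v => by
      by_cases h : G.Adj u v
      · rw [hcol h, hcol h.symm, hsymm h]
      · have h' : ¬ G.Adj v u := fun h' => h h'.symm
        simp [h, h']
    wt_comm := fun u v => by
      by_cases h : G.Adj u v
      · rw [hwt h, hwt h.symm, hsymm h]
      · have h' : ¬ G.Adj v u := fun h' => h h'.symm
        simp [h, h']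
    wt_pos := fun h => by rw [hwt h]; exact c.weight_pos _
    eq_of_col_eq := fun {u v w} huv huw h => by
      rw [hcol huv, hcol huw] at h
      by_contra hne
      exact c.color.valid (lineGraph_adj_mk huv huw hne) (Fin.ext h)
    exists_col := fun {u v j} huv hj hne => by
      rw [hcol huv] at hne
      obtain ⟨q, hq, hqj⟩ := c.exists_adj hθ (p := ⟨s(u, v), huv⟩) (j := ⟨j, hj⟩)
        (fun h => hne (by rw [h]))
      rcases exists_eq_mk_of_lineGraph_adj huv hq with ⟨w, hw, _, rfl⟩ | ⟨w, hw, _, rfl⟩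
      · exact ⟨w, Or.inl ⟨hw, by rw [hcol hw, hqj]⟩⟩
      · exact ⟨w, Or.inr ⟨hw, by rw [hcol hw, hqj]⟩⟩
    mul_wt_eq := fun {u v w} huv huw hvw h => by
      rw [hwt huv, hwt huw]
      refine c.mul_weight_eq (lineGraph_adj_mk huv huw hvw) fun r hr hc => ?_
      rcases exists_eq_mk_of_lineGraph_adj huv hr with ⟨z, hz, _, rfl⟩ | ⟨z, hz, _, rfl⟩
      · by_contra hne
        exact c.color.valid (lineGraph_adj_mk hz huw fun hzw => hne (by subst hzw; rfl)) hc
      · exact absurd (by rw [hcol hz, hcol huw, hc]) (h z hz)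
    mul_wt_eq_add := fun {u v w z} huv huw hvw hvz hzu h => by
      rw [hcol hvz, hcol huw] at h
      rw [hwt huv, hwt huw, hwt hvz]
      refine c.mul_weight_eq_add (lineGraph_adj_mk huv huw hvw) ?_ ?_ (Fin.ext h) ?_
      · rw [hsymm huv]
        exact lineGraph_adj_mk huv.symm hvz (Ne.symm hzu)
      · intro he
        have h1 : v ∈ s(u, w) := by
          rw [show s(u, w) = s(v, z) from congrArg Subtype.val he]
          exact Sym2.mem_mk_left _ _
        rcases Sym2.mem_iff.1 h1 with h1 | h1
        · exact huv.ne h1.symm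
        · exact hvw h1
      · intro s hs hc
        rcases exists_eq_mk_of_lineGraph_adj huv hs with ⟨x, hx, _, rfl⟩ | ⟨x, hx, _, rfl⟩
        · left
          by_contra hne
          exact c.color.valid (lineGraph_adj_mk hx huw fun hxw => hne (by subst hxw; rfl)) hc
        · right
          by_contra hne
          exact c.color.valid (lineGraph_adj_mk hx hvz fun hxw => hne (by subst hxw; rfl))
            (hc.trans (Fin.ext h).symm) }

end OfLineGraph

/-! ### Structure of net-like root graphs -/

namespace EdgeWeighting

set_option linter.unusedSectionVars false

variable {V : Type u} [Fintype V] [DecidableEq V] {G : SimpleGraph V} [DecidableRel G.Adj]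
  {k : ℕ} {θ : ℝ}

theorem three_le_degree {u x y z : V} (hx : G.Adj u x) (hy : G.Adj u y) (hz : G.Adj u z)
    (hxy : x ≠ y) (hxz : x ≠ z) (hyz : y ≠ z) : 3 ≤ G.degree u := by
  rw [← G.card_neighborFinset_eq_degree, ← card_eq_three.2 ⟨x, y, z, hxy, hxz, hyz, rfl⟩]
  refine card_le_card fun w hw => ?_
  simp only [mem_insert, mem_singleton] at hw
  rcases hw with rfl | rfl | rfl <;> simpa

theorem eq_of_degree_eq_one {u x y : V} (h : G.degree u = 1) (hx : G.Adj u x) (hy : G.Adj u y) :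
    x = y := by
  obtain ⟨z, _, hz⟩ := SimpleGraph.degree_eq_one_iff_existsUnique_adj.1 h
  exact (hz x hx).trans (hz y hy).symm

/-- The local structure of a root graph with smallest line graph eigenvalue greater than `-2`
that carries an edge weighting. -/
structure IsNetLike (G : SimpleGraph V) [DecidableRel G.Adj] : Prop where
  degree_le : ∀ v, G.degree v ≤ 3
  exists_leaf : ∀ v, G.degree v = 3 → ∃ l, G.Adj v l ∧ G.degree l = 1
  leaf_unique : ∀ u v w, G.Adj u v → G.Adj u w → G.degree v = 1 → G.degree w = 1 → v = w

theorem IsNetLike.exists_leaf_and_adj (hG : IsNetLike G) {u v : V} (huv : G.Adj u v)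
    (hu : G.degree u = 3) (hv : G.degree v ≠ 1) :
    ∃ l w, G.Adj u l ∧ G.degree l = 1 ∧ G.Adj u w ∧ G.degree w ≠ 1 ∧ l ≠ v ∧ l ≠ w ∧ v ≠ w ∧
      ∀ z, G.Adj u z → z = l ∨ z = v ∨ z = w := by
  obtain ⟨l, hul, hl⟩ := hG.exists_leaf u hu
  have hlv : l ≠ v := by rintro rfl; exact hv hl
  have hcard : #((G.neighborFinset u).erase l |>.erase v) = 1 := by
    rw [card_erase_of_mem (by simp [hlv.symm, huv]), card_erase_of_mem (by simpa using hul),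
      G.card_neighborFinset_eq_degree, hu]
  obtain ⟨w, hw⟩ := card_eq_one.1 hcard
  have hmem : ∀ z, (z ≠ v ∧ z ≠ l ∧ G.Adj u z) ↔ z = w := fun z => by
    have := congrArg (z ∈ ·) hw
    simpa using this
  obtain ⟨hwv, hwl, huw⟩ := (hmem w).2 rfl
  refine ⟨l, w, hul, hl, huw, fun h => hwl (hG.leaf_unique u w l huw hul h hl), hlv, hwl.symm,
    hwv.symm, fun z hz => ?_⟩
  by_cases h1 : z = l
  · exact Or.inl h1
  by_cases h2 : z = v
  · exact Or.inr (Or.inl h2)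
  exact Or.inr (Or.inr ((hmem z).1 ⟨h2, h1, hz⟩))

variable (c : EdgeWeighting G k θ)

include c

theorem mul_wt_leaf {u l x : V} (hul : G.Adj u l) (hl : G.degree l = 1) (hux : G.Adj u x)
    (hlx : l ≠ x) : θ * c.wt u l = c.wt u x := by
  refine c.mul_wt_eq hul hux hlx fun z hz h => ?_
  obtain rfl := eq_of_degree_eq_one hl hz hul.symm
  rw [c.col_comm] at h
  exact hlx (c.eq_of_col_eq hul hux h)

/-- Two further colours must occur on edges meeting `uv`. Each end has room for only one more edge,
so the colours sit at opposite ends, and the edge at `u` is the only one of its colour that meets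
`uv`. -/
theorem exists_adj_mul_wt_eq (hk : 3 ≤ k) (hdeg : ∀ v, G.degree v < 3) {u v : V}
    (huv : G.Adj u v) : ∃ w, G.Adj u w ∧ w ≠ v ∧ θ * c.wt u v = c.wt u w := by
  have hcol : ∃ i j, i < k ∧ j < k ∧ i ≠ c.col u v ∧ j ≠ c.col u v ∧ i ≠ j := by
    by_cases h0 : c.col u v = 0
    · exact ⟨1, 2, by omega⟩
    · by_cases h1 : c.col u v = 1
      · exact ⟨0, 2, by omega⟩
      · exact ⟨0, 1, by omega⟩
  have two : ∀ {i j : ℕ} {u v x y : V}, G.Adj u v → G.Adj u x → c.col u x = i → G.Adj u y →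
      c.col u y = j → i ≠ c.col u v → j ≠ c.col u v → i ≠ j → False := by
    intro i j u v x y huv hux hi huy hj hiv hjv hij
    have h1 : v ≠ x := by rintro rfl; exact hiv hi.symm
    have h2 : v ≠ y := by rintro rfl; exact hjv hj.symm
    have h3 : x ≠ y := by rintro rfl; exact hij (hi.symm.trans hj)
    exact absurd (hdeg u) (not_lt.2 (three_le_degree huv hux huy h1 h2 h3))
  have one : ∀ {i j : ℕ} {u v x y : V}, G.Adj u v → G.Adj u x → c.col u x = i → G.Adj v y →
      c.col v y = j → i ≠ c.col u v → j ≠ c.col u v → i ≠ j →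
      ∃ w, G.Adj u w ∧ w ≠ v ∧ θ * c.wt u v = c.wt u w := by
    intro i j u v x y huv hux hi hvy hj hiv hjv hij
    have h1 : x ≠ v := by rintro rfl; exact hiv hi.symm
    refine ⟨x, hux, h1, c.mul_wt_eq huv hux h1.symm fun z hvz hz => ?_⟩
    refine two huv.symm hvz (hz.trans hi) hvy hj ?_ ?_ hij
    · rwa [c.col_comm]
    · rwa [c.col_comm]
  obtain ⟨i, j, hi, hj, hiv, hjv, hij⟩ := hcol
  obtain ⟨x, ⟨hx, hxi⟩ | ⟨hx, hxi⟩⟩ := c.exists_col huv hi hiv <;>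
  obtain ⟨y, ⟨hy, hyj⟩ | ⟨hy, hyj⟩⟩ := c.exists_col huv hj hjv
  · exact (two huv hx hxi hy hyj hiv hjv hij).elim
  · exact one huv hx hxi hy hyj hiv hjv hij
  · exact one huv hy hyj hx hxi hjv hiv hij.symm
  · rw [c.col_comm] at hiv hjv
    exact (two huv.symm hx hxi hy hyj hiv hjv hij).elim

/-- If all degrees were below 3, applying `exists_adj_mul_wt_eq` twice at `u` would lead from `uv`
to the other edge at `u` and back, giving `θ² = 1`. -/
theorem exists_degree_eq_three (hG : IsNetLike G) (hθ : 0 < θ) (hθ1 : θ ≠ 1) (hk : 3 ≤ k)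
    {u v : V} (huv : G.Adj u v) : ∃ u, G.degree u = 3 := by
  by_contra! hne
  have hdeg : ∀ v, G.degree v < 3 := fun v => lt_of_le_of_ne (hG.degree_le v) (hne v)
  obtain ⟨w, huw, hwv, h1⟩ := c.exists_adj_mul_wt_eq hk hdeg huv
  obtain ⟨x, hux, hxw, h2⟩ := c.exists_adj_mul_wt_eq hk hdeg huw
  have hxv : x = v := by
    by_contra hxv
    exact absurd (hdeg u) (not_lt.2 (three_le_degree huv huw hux hwv.symm (Ne.symm hxv) hxw.symm))
  subst hxv
  exact hθ1 (eq_one_of_mul_eq_of_mul_eq hθ (c.wt_pos huv) h1 h2)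

/-- The leaf at `u` gives both non-pendant edges at `u` the same weight, `θ` times that of the
pendant edge. Unless the colours of the other two edges at `u` both reappear at `v`, this forces `θ
= 1`. So `v` has degree 3 and the same weight pattern. -/
theorem degree_eq_three_of_adj (hG : IsNetLike G) (hθ : 0 < θ) (hθ1 : θ ≠ 1) (hθ2 : θ < 2)
    {u v : V} (huv : G.Adj u v) (hu : G.degree u = 3) (hv : G.degree v ≠ 1) :
    G.degree v = 3 ∧ θ ^ 2 = θ + 1 := by
  obtain ⟨l, w, hul, hl, huw, hw, hlv, hlw, hvw, hall⟩ := hG.exists_leaf_and_adj huv hu hv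
  have hposl := c.wt_pos hul
  have hposv := c.wt_pos huv
  have h1 := c.mul_wt_leaf hul hl huv hlv
  have h2 := c.mul_wt_leaf hul hl huw hlw
  obtain ⟨z, hvz, hz⟩ : ∃ z, G.Adj v z ∧ c.col v z = c.col u w := by
    by_contra! hn
    have h3 := c.mul_wt_eq huv huw hvw hn
    rw [← h2, h1] at h3
    exact hθ1 (mul_right_cancel₀ hposv.ne' (h3.trans (one_mul _).symm))
  obtain ⟨y, hvy, hy⟩ : ∃ y, G.Adj v y ∧ c.col v y = c.col u l := by
    by_contra! hn
    exact hθ1 (eq_one_of_mul_eq_of_mul_eq hθ hposl h1 (c.mul_wt_eq huv hul hlv.symm hn))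
  have hzu : z ≠ u := by
    rintro rfl
    rw [c.col_comm] at hz
    exact hvw (c.eq_of_col_eq huv huw hz)
  have hyu : y ≠ u := by
    rintro rfl
    rw [c.col_comm] at hy
    exact hlv (c.eq_of_col_eq huv hul hy).symm
  have hzy : z ≠ y := by
    rintro rfl
    exact hlw (c.eq_of_col_eq hul huw (hy.symm.trans hz))
  have hv3 : G.degree v = 3 := le_antisymm (hG.degree_le v)
    (three_le_degree hvz hvy huv.symm hzy hzu hyu)
  refine ⟨hv3, ?_⟩
  have hu1 : G.degree u ≠ 1 := by omega
  obtain ⟨m, x, hvm, hm, hvx, hx, hmu, hmx, hux, hall'⟩ :=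
    hG.exists_leaf_and_adj huv.symm hv3 hu1
  have h3 := c.mul_wt_leaf hvm hm huv.symm hmu
  have h4 := c.mul_wt_leaf hvm hm hvx hmx
  have h5 := c.mul_wt_eq_add huv huw hvw hvz hzu hz
  rw [c.wt_comm v u] at h3
  -- If the edge at `v` sharing the colour of `uw` is pendant, then `θ = 1 + 1/θ`; if it is the
  -- other non-pendant edge, all three weights agree and `θ = 2`.
  rcases hall' z hvz with rfl | rfl | rfl
  · have h6 : (θ ^ 2 - (θ + 1)) * c.wt v z = 0 := by
      linear_combination (θ - 1) * h3 + h5 - h2 + h1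
    rcases mul_eq_zero.1 h6 with h | h
    · linarith
    · exact absurd h (c.wt_pos hvm).ne'
  · exact absurd rfl hzu
  · have h6 : (θ - 2) * c.wt u v = 0 := by
      linear_combination h5 - h2 + h1 - h4 + h3
    rcases mul_eq_zero.1 h6 with h | h
    · linarith
    · exact absurd h hposv.ne'

/-- The root graph contains either a triangle with three pendant edges, which then is everything,
or a path with five edges. -/
theorem exists_net_or_path (hG : IsNetLike G) (hθ : 0 < θ) (hθ1 : θ ≠ 1) (hθ2 : θ < 2)
    (hk : 3 ≤ k) {u v : V} (huv : G.Adj u v) : θ ^ 2 = θ + 1 ∧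
    ((∃ x₀ x₁ x₂ y₀ y₁ y₂, [x₀, x₁, x₂, y₀, y₁, y₂].Nodup ∧ G.Adj x₀ x₁ ∧ G.Adj x₀ x₂ ∧
        G.Adj x₁ x₂ ∧ G.Adj x₀ y₀ ∧ G.Adj x₁ y₁ ∧ G.Adj x₂ y₂ ∧
        (∀ z, G.Adj x₀ z → z = y₀ ∨ z = x₁ ∨ z = x₂) ∧
        (∀ z, G.Adj x₁ z → z = y₁ ∨ z = x₀ ∨ z = x₂) ∧
        (∀ z, G.Adj x₂ z → z = y₂ ∨ z = x₀ ∨ z = x₁) ∧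
        (∀ z, G.Adj y₀ z → z = x₀) ∧ (∀ z, G.Adj y₁ z → z = x₁) ∧ (∀ z, G.Adj y₂ z → z = x₂)) ∨
      ∃ x₀ x₁ x₂ x₃ x₄ x₅, [x₀, x₁, x₂, x₃, x₄, x₅].Nodup ∧ G.Adj x₀ x₁ ∧ G.Adj x₁ x₂ ∧
        G.Adj x₂ x₃ ∧ G.Adj x₃ x₄ ∧ G.Adj x₄ x₅) := by
  obtain ⟨x₀, hx₀⟩ := c.exists_degree_eq_three hG hθ hθ1 hk huv
  obtain ⟨x₁, h01, hx₁⟩ : ∃ x, G.Adj x₀ x ∧ G.degree x ≠ 1 := by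
    by_contra! hn
    have : G.degree x₀ ≤ 1 := by
      rw [← G.card_neighborFinset_eq_degree, card_le_one]
      intro a ha b hb
      rw [SimpleGraph.mem_neighborFinset] at ha hb
      exact hG.leaf_unique _ _ _ ha hb (hn a ha) (hn b hb)
    omega
  obtain ⟨hx₁3, hθφ⟩ := c.degree_eq_three_of_adj hG hθ hθ1 hθ2 h01 hx₀ hx₁
  refine ⟨hθφ, ?_⟩
  obtain ⟨y₀, x₂, h0y, hy₀, h02, hx₂, hy0x1, hy0x2, h12, hall₀⟩ :=
    hG.exists_leaf_and_adj h01 hx₀ hx₁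
  have hx₂3 := (c.degree_eq_three_of_adj hG hθ hθ1 hθ2 h02 hx₀ hx₂).1
  obtain ⟨y₁, w₁, h1y, hy₁, h1w, hw₁, hy1x0, hy1w1, h0w1, hall₁⟩ :=
    hG.exists_leaf_and_adj h01.symm hx₁3 (by omega)
  obtain ⟨y₂, w₂, h2y, hy₂, h2w, hw₂, hy2x0, hy2w2, h0w2, hall₂⟩ :=
    hG.exists_leaf_and_adj h02.symm hx₂3 (by omega)
  have hleaf : ∀ {x y : V}, G.degree x = 3 → G.degree y = 1 → x ≠ y := by
    rintro x y hx hy rfl; omega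
  have hleaf' : ∀ {x y x' y' : V}, G.Adj x y → G.Adj x' y' → G.degree y = 1 → x ≠ x' → y ≠ y' := by
    rintro x y x' y' h h' hy hne rfl
    exact hne (eq_of_degree_eq_one hy h.symm h'.symm)
  -- The non-leaf neighbours of `x₀` either are adjacent, closing a triangle, or the chain continues
  -- to `w₁`, whose leaf then ends a path with five edges.
  by_cases hw : w₁ = x₂
  · left
    subst hw
    have hw₂ : w₂ = x₁ := by
      rcases hall₂ x₁ h1w.symm with h | h | h
      · exact absurd h (hleaf hx₁3 hy₂)
      · exact absurd h h01.ne'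
      · exact h.symm
    subst hw₂
    refine ⟨x₀, w₂, w₁, y₀, y₁, y₂, ?_, h01, h02, h1w, h0y, h1y, h2y, hall₀, hall₁, hall₂,
      fun z hz => eq_of_degree_eq_one hy₀ hz h0y.symm, fun z hz => eq_of_degree_eq_one hy₁ hz h1y.symm,
      fun z hz => eq_of_degree_eq_one hy₂ hz h2y.symm⟩
    simp only [List.nodup_cons, List.mem_cons, List.not_mem_nil, or_false, not_or, List.nodup_nil,
      not_false_eq_true, and_true]
    exact ⟨⟨h01.ne, h02.ne, hleaf hx₀ hy₀, hleaf hx₀ hy₁, hleaf hx₀ hy₂⟩,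
      ⟨h12, hleaf hx₁3 hy₀, hleaf hx₁3 hy₁, hleaf hx₁3 hy₂⟩,
      ⟨hleaf hx₂3 hy₀, hleaf hx₂3 hy₁, hleaf hx₂3 hy₂⟩,
      ⟨hleaf' h0y h1y hy₀ h01.ne, hleaf' h0y h2y hy₀ h02.ne⟩, hleaf' h1y h2y hy₁ h12⟩
  · right
    have hw₁3 := (c.degree_eq_three_of_adj hG hθ hθ1 hθ2 h1w hx₁3 hw₁).1
    obtain ⟨m, hwm, hm⟩ := hG.exists_leaf w₁ hw₁3
    refine ⟨m, w₁, x₁, x₀, x₂, y₂, ?_, hwm.symm, h1w.symm, h01.symm, h02, h2y⟩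
    simp only [List.nodup_cons, List.mem_cons, List.not_mem_nil, or_false, not_or, List.nodup_nil,
      not_false_eq_true, and_true]
    exact ⟨⟨(hleaf hw₁3 hm).symm, (hleaf hx₁3 hm).symm, (hleaf hx₀ hm).symm, (hleaf hx₂3 hm).symm,
      hleaf' hwm h2y hm hw⟩,
      ⟨h1w.ne', h0w1.symm, hw, hleaf hw₁3 hy₂⟩,
      ⟨h01.ne', h12, hleaf hx₁3 hy₂⟩, ⟨h02.ne, hleaf hx₀ hy₂⟩, hleaf hx₂3 hy₂⟩

end EdgeWeighting

end HoffmanGL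

namespace HoffmanGL

universe u v

open Finset Matrix

/-! ### Induced subgraphs of line graphs -/

section Embedding

/-- Extending `y` by zero off the image preserves both its norm and the quadratic form. -/
theorem lambdaMin_mul_dotProduct_le_of_embedding {V : Type u} {W : Type v} [Fintype V]
    [DecidableEq V] [Fintype W] [DecidableEq W]
    {H : SimpleGraph V} {K : SimpleGraph W} [DecidableRel H.Adj] [DecidableRel K.Adj]
    (f : K ↪g H) (y : W → ℝ) : lambdaMin H * (y ⬝ᵥ y) ≤ y ⬝ᵥ K.adjMatrix ℝ *ᵥ y := by
  let z : V → ℝ := fun p => ∑ i, if p = f i then y i else 0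
  have hz : ∀ g : V → ℝ, z ⬝ᵥ g = ∑ i, y i * g (f i) := fun g => by
    simp only [z, dotProduct, sum_mul, ite_mul, zero_mul]
    rw [sum_comm]
    simp
  have hzf : ∀ i, z (f i) = y i := fun i => by
    simp [z, f.injective.eq_iff]
  have hAz : ∀ i, (H.adjMatrix ℝ *ᵥ z) (f i) = (K.adjMatrix ℝ *ᵥ y) i := fun i => by
    change H.adjMatrix ℝ (f i) ⬝ᵥ z = _
    rw [dotProduct_comm, hz, Matrix.mulVec, dotProduct]
    refine sum_congr rfl fun j _ => ?_
    simp [SimpleGraph.adjMatrix_apply, mul_comm]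
  have := lambdaMin_mul_dotProduct_le H z
  rw [hz, hz] at this
  simp only [hzf, hAz] at this
  exact this

/-- A list of edges of `G`, given by a list of pairs and an injective labelling of vertices,
spans the induced subgraph of the line graph that is determined by the pairs. -/
def lineGraphEmbedding {V : Type u} {G : SimpleGraph V} {m n : ℕ} (E : Fin m → Sym2 (Fin n))
    (K : SimpleGraph (Fin m)) (hE : Function.Injective E)
    (hK : ∀ i j, K.Adj i j ↔ E i ≠ E j ∧ ∃ x, x ∈ E i ∧ x ∈ E j)
    (g : Fin n → V) (hg : Function.Injective g) (hgE : ∀ i, (E i).map g ∈ G.edgeSet) :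
    K ↪g G.lineGraph where
  toFun i := ⟨(E i).map g, hgE i⟩
  inj' i j h := hE (Sym2.map.injective hg (congrArg Subtype.val h))
  map_rel_iff' {i j} := by
    change G.lineGraph.Adj ⟨(E i).map g, hgE i⟩ ⟨(E j).map g, hgE j⟩ ↔ _
    rw [SimpleGraph.lineGraph_adj_iff_exists, hK]
    refine and_congr ?_ ?_
    · rw [Ne, Subtype.mk.injEq, (Sym2.map.injective hg).eq_iff]
    · simp only [Sym2.mem_map]
      constructor
      · rintro ⟨_, ⟨x, hx, rfl⟩, y, hy, hxy⟩
        obtain rfl := hg hxy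
        exact ⟨_, hx, hy⟩
      · rintro ⟨x, hx, hy⟩
        exact ⟨g x, ⟨x, hx, rfl⟩, x, hy, rfl⟩

/-- The edges of a path with vertices `0, …, 5`. -/
def pathEdge : Fin 5 → Sym2 (Fin 6) := ![s(0, 1), s(1, 2), s(2, 3), s(3, 4), s(4, 5)]

theorem pathEdge_injective : Function.Injective pathEdge := by
  unfold pathEdge; decide

theorem pathGraph_adj_iff_pathEdge (i j : Fin 5) :
    (SimpleGraph.pathGraph 5).Adj i j ↔
      pathEdge i ≠ pathEdge j ∧ ∃ x, x ∈ pathEdge i ∧ x ∈ pathEdge j := by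
  rw [SimpleGraph.pathGraph_adj]
  revert i j
  unfold pathEdge; decide

theorem lambdaMin_mul_le_of_path {V : Type u} {G : SimpleGraph V} [Finite G.edgeSet]
    {x₀ x₁ x₂ x₃ x₄ x₅ : V} (hx : [x₀, x₁, x₂, x₃, x₄, x₅].Nodup) (h01 : G.Adj x₀ x₁)
    (h12 : G.Adj x₁ x₂) (h23 : G.Adj x₂ x₃) (h34 : G.Adj x₃ x₄) (h45 : G.Adj x₄ x₅) :
    14 * lambdaMin G.lineGraph ≤ -24 := by
  classical
  have := Fintype.ofFinite G.edgeSet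
  let f : SimpleGraph.pathGraph 5 ↪g G.lineGraph :=
    lineGraphEmbedding pathEdge _ pathEdge_injective pathGraph_adj_iff_pathEdge
      [x₀, x₁, x₂, x₃, x₄, x₅].get (List.nodup_iff_injective_get.1 hx) (by
        intro i
        fin_cases i
        exacts [h01, h12, h23, h34, h45])
  -- An integer approximation to the eigenvector `(1, -√3, 2, -√3, 1)` for `-√3`; its quotient
  -- `-24/14` is already below minus the golden ratio.
  have := lambdaMin_mul_dotProduct_le_of_embedding f ![1, -2, 2, -2, 1]
  simp [dotProduct, mulVec, Fin.sum_univ_five, SimpleGraph.adjMatrix_apply,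
    SimpleGraph.pathGraph_adj] at this
  linarith

instance : DecidableRel sunGraph.Adj := fun i j =>
  decidable_of_iff (s(i, j) ∈ ({s(0, 3), s(0, 4), s(1, 3), s(1, 5), s(2, 4), s(2, 5),
    s(3, 4), s(3, 5), s(4, 5)} : Finset (Sym2 (Fin 6))) ∧ i ≠ j) (by
      simp [sunGraph])

/-- The edges of a triangle `0, 1, 2` with pendant vertices `3, 4, 5`. -/
def netEdge : Fin 6 → Sym2 (Fin 6) := ![s(0, 3), s(1, 4), s(2, 5), s(0, 1), s(0, 2), s(1, 2)]

theorem netEdge_injective : Function.Injective netEdge := by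
  unfold netEdge; decide

theorem sunGraph_adj_iff_netEdge (i j : Fin 6) :
    sunGraph.Adj i j ↔ netEdge i ≠ netEdge j ∧ ∃ x, x ∈ netEdge i ∧ x ∈ netEdge j := by
  revert i j
  unfold netEdge; decide

/-- By `hcl` the embedded sun is closed under adjacency, so connectedness makes the embedding
surjective. -/
theorem nonempty_lineGraph_iso_sunGraph {V : Type u} {G : SimpleGraph V}
    (hc : G.lineGraph.Connected) (g : Fin 6 → V) (hg : Function.Injective g)
    (hgE : ∀ i, (netEdge i).map g ∈ G.edgeSet)
    (hcl : ∀ i, ∀ z, G.Adj (g i) z → ∃ j, s(g i, z) = (netEdge j).map g) :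
    Nonempty (G.lineGraph ≃g sunGraph) := by
  let f : sunGraph ↪g G.lineGraph := lineGraphEmbedding netEdge _ netEdge_injective
    sunGraph_adj_iff_netEdge g hg hgE
  have hstep : ∀ e e', G.lineGraph.Adj e e' → e ∈ Set.range f → e' ∈ Set.range f := by
    rintro _ ⟨e', he'⟩ hadj ⟨i, rfl⟩
    rw [SimpleGraph.lineGraph_adj_iff_exists] at hadj
    obtain ⟨_, v, hv, hv'⟩ := hadj
    obtain ⟨j, -, rfl⟩ := Sym2.mem_map.1 hv
    obtain ⟨z, rfl⟩ := Sym2.mem_iff_exists.1 hv'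
    obtain ⟨l, hl⟩ := hcl j z he'
    exact ⟨l, Subtype.ext hl.symm⟩
  have hall : ∀ e e', G.lineGraph.Reachable e e' → e ∈ Set.range f → e' ∈ Set.range f := by
    rintro e e' ⟨w⟩ he
    induction w with
    | nil => exact he
    | cons h _ ih => exact ih (hstep _ _ h he)
  have hsurj : Function.Surjective f := fun e =>
    hall (f 0) e (hc.preconnected _ _) ⟨0, rfl⟩
  exact ⟨(RelIso.ofSurjective f hsurj).symm⟩

end Embedding

/-! ### Invariance under isomorphism -/

section Iso

variable {V : Type u} {W : Type v} [Finite V] [Finite W] {H : SimpleGraph V} {K : SimpleGraph W}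

theorem adjSpectrum_eq_of_iso (e : H ≃g K) : adjSpectrum H = adjSpectrum K := by
  classical
  have := Fintype.ofFinite V
  have := Fintype.ofFinite W
  rw [adjSpectrum_eq, adjSpectrum_eq,
    ← AlgEquiv.spectrum_eq (Matrix.reindexAlgEquiv ℝ ℝ e.toEquiv) (H.adjMatrix ℝ)]
  congr 1
  ext i j
  have : H.Adj (e.symm i) (e.symm j) ↔ K.Adj i j := e.symm.map_adj_iff
  simp only [Matrix.coe_reindexAlgEquiv, Matrix.reindex_apply, Matrix.submatrix_apply,
    SimpleGraph.adjMatrix_apply]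
  exact if_congr this rfl rfl

theorem lambdaMin_eq_of_iso (e : H ≃g K) : lambdaMin H = lambdaMin K := by
  rw [lambdaMin, lambdaMin, adjSpectrum_eq_of_iso e]

theorem isNontriviallyHoffmanColorable_of_iso (e : H ≃g K)
    (h : IsNontriviallyHoffmanColorable H) : IsNontriviallyHoffmanColorable K := by
  obtain ⟨⟨hne, hχ⟩, hb, hm⟩ := h
  refine ⟨⟨fun hK => hne ?_, ?_⟩, fun hK => hb (hK.of_hom e.toHom), ?_⟩
  · ext p q
    rw [← e.map_adj_iff]
    simp [hK]
  · rw [← SimpleGraph.chromaticNumber_congr e, hχ, hoffmanBound, hoffmanBound, lambdaMin_eq_of_iso e,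
      lambdaMax, lambdaMax, adjSpectrum_eq_of_iso e]
  · rintro ⟨r, m, ⟨f⟩⟩
    exact hm ⟨r, m, ⟨e.trans f⟩⟩

end Iso

end HoffmanGL

namespace HoffmanGL

universe u v

open Finset Matrix

/-! ### Spectrum and colouring of the sun -/

section Sun

theorem sunGraph_mulVec (y : Fin 6 → ℝ) : sunGraph.adjMatrix ℝ *ᵥ y =
    ![y 3 + y 4, y 3 + y 5, y 4 + y 5, y 0 + y 1 + y 4 + y 5, y 0 + y 2 + y 3 + y 5,
      y 1 + y 2 + y 3 + y 4] := by
  ext i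
  rw [adjMatrix_mulVec_eq_sum, Fin.sum_univ_six]
  fin_cases i <;> simp [sunGraph]

/-- The sum of the triangle coordinates is killed by the first factor. Once that sum vanishes, each
triangle coordinate is killed by the second. If all of them are zero, so are the outer coordinates.
-/
theorem mem_adjSpectrum_sunGraph {μ : ℝ} (h : μ ∈ adjSpectrum sunGraph) :
    (μ ^ 2 - 2 * μ - 4) * (μ ^ 2 + μ - 1) = 0 := by
  obtain ⟨y, hy0, hy⟩ := (mem_adjSpectrum_iff _).1 h
  rw [sunGraph_mulVec] at hy
  have h0 : y 3 + y 4 = μ * y 0 := congrFun hy 0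
  have h1 : y 3 + y 5 = μ * y 1 := congrFun hy 1
  have h2 : y 4 + y 5 = μ * y 2 := congrFun hy 2
  have h3 : y 0 + y 1 + y 4 + y 5 = μ * y 3 := congrFun hy 3
  have h4 : y 0 + y 2 + y 3 + y 5 = μ * y 4 := congrFun hy 4
  have h5 : y 1 + y 2 + y 3 + y 4 = μ * y 5 := congrFun hy 5
  by_contra hne
  obtain ⟨hne1, hne2⟩ := mul_ne_zero_iff.1 hne
  have hq : y 3 + y 4 + y 5 = 0 := by
    apply (mul_eq_zero.1 (?_ : (μ ^ 2 - 2 * μ - 4) * (y 3 + y 4 + y 5) = 0)).resolve_left hne1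
    linear_combination (-2) * h0 - 2 * h1 - 2 * h2 - μ * h3 - μ * h4 - μ * h5
  have e3 : y 3 = 0 := by
    apply (mul_eq_zero.1 (?_ : (μ ^ 2 + μ - 1) * y 3 = 0)).resolve_left hne2
    linear_combination (1 + μ) * hq - h0 - h1 - μ * h3
  have e4 : y 4 = 0 := by
    apply (mul_eq_zero.1 (?_ : (μ ^ 2 + μ - 1) * y 4 = 0)).resolve_left hne2
    linear_combination (1 + μ) * hq - h0 - h2 - μ * h4
  have e5 : y 5 = 0 := by linarith
  rw [e3, e4, e5] at h3 h4 h5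
  refine hy0 (funext fun i => ?_)
  have e0 : y 0 = 0 := by linarith
  have e1 : y 1 = 0 := by linarith
  have e2 : y 2 = 0 := by linarith
  fin_cases i <;> assumption

theorem lambdaMax_sunGraph : lambdaMax sunGraph = 1 + √5 := by
  have h5 : √5 ^ 2 = 5 := Real.sq_sqrt (by norm_num)
  have h2 : 2 < √5 := Real.lt_sqrt_of_sq_lt (by norm_num)
  refine (IsGreatest.csSup_eq ⟨(mem_adjSpectrum_iff _).2
    ⟨![2, 2, 2, 1 + √5, 1 + √5, 1 + √5], ?_, ?_⟩, fun μ hμ => ?_⟩)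
  · intro h
    have := congrFun h 0
    simp at this
  · rw [sunGraph_mulVec]
    ext i
    fin_cases i <;> simp <;> nlinarith
  · rcases mul_eq_zero.1 (mem_adjSpectrum_sunGraph hμ) with h | h <;> nlinarith

theorem lambdaMin_sunGraph : lambdaMin sunGraph = -(1 + √5) / 2 := by
  have h5 : √5 ^ 2 = 5 := Real.sq_sqrt (by norm_num)
  have h2 : 2 < √5 := Real.lt_sqrt_of_sq_lt (by norm_num)
  -- This eigenvector is antisymmetric under the reflection exchanging 3 with 4 and 1 with 2.
  refine (IsLeast.csInf_eq ⟨(mem_adjSpectrum_iff _).2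
    ⟨![0, 2, -2, -(1 + √5), (1 + √5), 0], ?_, ?_⟩, fun μ hμ => ?_⟩)
  · intro h
    have := congrFun h 1
    simp at this
  · rw [sunGraph_mulVec]
    ext i
    fin_cases i <;> simp <;> nlinarith
  · rcases mul_eq_zero.1 (mem_adjSpectrum_sunGraph hμ) with h | h <;> nlinarith

theorem neg_two_lt_lambdaMin_sunGraph : -2 < lambdaMin sunGraph := by
  have : √5 < 3 := (Real.sqrt_lt' (by norm_num)).2 (by norm_num)
  rw [lambdaMin_sunGraph]; linarith

theorem not_isBipartite_sunGraph : ¬ sunGraph.IsBipartite := by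
  rintro ⟨C⟩
  have h1 := C.valid (show sunGraph.Adj 3 4 by decide)
  have h2 := C.valid (show sunGraph.Adj 3 5 by decide)
  have h3 := C.valid (show sunGraph.Adj 4 5 by decide)
  omega

theorem chromaticNumber_sunGraph : sunGraph.chromaticNumber = 3 := by
  refine SimpleGraph.chromaticNumber_eq_iff_colorable_not_colorable (n := 2).2 ⟨?_, not_isBipartite_sunGraph⟩
  exact ⟨SimpleGraph.Coloring.mk ![2, 1, 0, 0, 1, 2] (by decide)⟩

theorem isNontriviallyHoffmanColorable_sunGraph : IsNontriviallyHoffmanColorable sunGraph := by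
  refine ⟨⟨?_, ?_⟩, not_isBipartite_sunGraph, ?_⟩
  · rw [SimpleGraph.ne_bot_iff_exists_adj]
    exact ⟨0, 3, by decide⟩
  · have : 0 < √5 := Real.sqrt_pos.2 (by norm_num)
    rw [chromaticNumber_sunGraph, hoffmanBound, lambdaMax_sunGraph, lambdaMin_sunGraph]
    have h : (1 + √5) / (-(1 + √5) / 2) = -2 := by
      field_simp
    rw [h]
    norm_num
  · rintro ⟨r, m, ⟨e⟩⟩
    -- In a complete multipartite graph non-adjacency is transitive; here it fails for 0, 1, 4.
    have h1 : ¬ sunGraph.Adj 0 1 := by decide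
    have h2 : ¬ sunGraph.Adj 1 4 := by decide
    have h3 : sunGraph.Adj 0 4 := by decide
    rw [← e.map_adj_iff, SimpleGraph.completeEquipartiteGraph_adj] at h1 h2 h3
    rw [not_not] at h1 h2
    exact h3 (h1.trans h2)

theorem connected_sunGraph : sunGraph.Connected := by
  have h : ∀ i, sunGraph.Reachable 3 i := by
    have h34 : sunGraph.Adj 3 4 := by decide
    have h35 : sunGraph.Adj 3 5 := by decide
    have h30 : sunGraph.Adj 3 0 := by decide
    have h31 : sunGraph.Adj 3 1 := by decide
    have h42 : sunGraph.Adj 4 2 := by decide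
    intro i
    fin_cases i
    exacts [h30.reachable, h31.reachable, h34.reachable.trans h42.reachable, .rfl, h34.reachable,
      h35.reachable]
  exact ⟨fun i j => (h i).symm.trans (h j)⟩

end Sun

/-! ### The sun as the line graph of the net -/

section LineGraph

/-- Without petals, a generalized line graph is a line graph. -/
def generalizedLineGraphIsoLineGraph {V : Type u} (G : SimpleGraph V) (a : V → ℕ)
    (h : ∀ v, a v = 0) : generalizedLineGraph G a ≃g G.lineGraph where
  toEquiv :=
    have : IsEmpty (Σ v : V, Fin (a v) × Fin 2) := ⟨fun p => (h p.1 ▸ p.2.1).elim0⟩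
    Equiv.sumEmpty _ _
  map_rel_iff' {p q} := by
    have hp : ∀ p : Σ v : V, Fin (a v) × Fin 2, False := fun p => (h p.1 ▸ p.2.1).elim0
    rcases p with e | p
    · rcases q with f | q
      · exact Iff.rfl
      · exact (hp q).elim
    · exact (hp p).elim

/-- The net: a triangle with a pendant vertex at each of its vertices. -/
def netGraph : SimpleGraph (Fin 6) := SimpleGraph.fromEdgeSet (Set.range netEdge)

theorem mem_edgeSet_netGraph (e : Sym2 (Fin 6)) : e ∈ netGraph.edgeSet ↔ ∃ i, netEdge i = e := by
  rw [netGraph, SimpleGraph.edgeSet_fromEdgeSet]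
  constructor
  · exact fun h => h.1
  · rintro ⟨i, rfl⟩
    refine ⟨⟨i, rfl⟩, ?_⟩
    have : ∀ i, ¬ (netEdge i).IsDiag := by unfold netEdge; decide
    exact this i

theorem isGeneralizedLineGraph_sunGraph : IsGeneralizedLineGraph sunGraph := by
  let f : sunGraph ↪g netGraph.lineGraph := lineGraphEmbedding netEdge _ netEdge_injective
    sunGraph_adj_iff_netEdge id Function.injective_id
    (fun i => (mem_edgeSet_netGraph _).2 ⟨i, by rw [Sym2.map_id]; rfl⟩)
  have hf : Function.Surjective f := by
    rintro ⟨e, he⟩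
    obtain ⟨i, rfl⟩ := (mem_edgeSet_netGraph _).1 he
    exact ⟨i, Subtype.ext (by change (netEdge i).map id = _; rw [Sym2.map_id]; rfl)⟩
  exact ⟨6, netGraph, fun _ => 0, ⟨(RelIso.ofSurjective f hf).trans
    (generalizedLineGraphIsoLineGraph netGraph _ fun _ => rfl).symm⟩⟩

end LineGraph

/-! ### Assembly of the classification -/

section Main

theorem eq_zero_and_isNetLike {V : Type u} [Fintype V] [DecidableEq V] {G : SimpleGraph V}
    [DecidableRel G.Adj] {a : V → ℕ} (hc : (generalizedLineGraph G a).Connected)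
    (hH : IsNontriviallyHoffmanColorable (generalizedLineGraph G a))
    (hmin : -2 < lambdaMin (generalizedLineGraph G a)) :
    (∀ v, a v = 0) ∧ EdgeWeighting.IsNetLike G := by
  classical
  obtain ⟨c⟩ := nonempty_weightedColoring _ hc hH.1
  have hk := three_le_chromaticNumber hH.2.1
  have hθ : 0 < -lambdaMin (generalizedLineGraph G a) := neg_pos.2 (lambdaMin_neg _ hH.1.1)
  have hθ1 : -lambdaMin (generalizedLineGraph G a) ≠ 1 := fun h =>
    hH.2.2 (isRegularCompleteMultipartite_of_neg_one_le_lambdaMin _ hc (by linarith))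
  have huniq := fun u v w huv huw => leaf_unique c hθ hθ1 (u := u) (v := v) (w := w) huv huw
  obtain ⟨ha, hdeg, hleaf⟩ := eq_zero_and_degree_le_three (card_edgeFinset_add_sum_le hmin)
    (fun v hv => hk.trans (le_degree_add_of_pos c hθ hv))
    (fun u v huv hv => hk.trans (le_degree_add_of_adj_leaf c hθ huv hv)) huniq
  exact ⟨ha, hdeg, hleaf, fun u v w huv huw hv hw =>
    huniq u v w huv huw (by rw [ha, hv]) (by rw [ha, hw])⟩

theorem nonempty_lineGraph_iso_sunGraph_of_isNetLike {V : Type u} [Fintype V] [DecidableEq V]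
    {G : SimpleGraph V} [DecidableRel G.Adj] (hc : G.lineGraph.Connected)
    (hH : IsNontriviallyHoffmanColorable G.lineGraph) (hmin : -2 < lambdaMin G.lineGraph)
    (hG : EdgeWeighting.IsNetLike G) : Nonempty (G.lineGraph ≃g sunGraph) := by
  classical
  obtain ⟨c⟩ := nonempty_weightedColoring _ hc hH.1
  have hk := three_le_chromaticNumber hH.2.1
  have hθ : 0 < -lambdaMin G.lineGraph := neg_pos.2 (lambdaMin_neg _ hH.1.1)
  have hθ1 : -lambdaMin G.lineGraph ≠ 1 := fun h =>
    hH.2.2 (isRegularCompleteMultipartite_of_neg_one_le_lambdaMin _ hc (by linarith))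
  obtain ⟨⟨e, he⟩⟩ := hc.nonempty
  induction e with | h u v
  obtain ⟨hφ, h | h⟩ := (c.toEdgeWeighting hθ).exists_net_or_path hG hθ hθ1 (by linarith) hk he
  · obtain ⟨x₀, x₁, x₂, y₀, y₁, y₂, hnd, h01, h02, h12, h0, h1, h2, hx₀, hx₁, hx₂, hy₀, hy₁, hy₂⟩ := h
    refine nonempty_lineGraph_iso_sunGraph hc [x₀, x₁, x₂, y₀, y₁, y₂].get
      (List.nodup_iff_injective_get.1 hnd) ?_ ?_
    · intro i
      fin_cases i
      exacts [h0, h1, h2, h01, h02, h12]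
    · intro i z hz
      fin_cases i
      · rcases hx₀ z hz with rfl | rfl | rfl
        exacts [⟨0, rfl⟩, ⟨3, rfl⟩, ⟨4, rfl⟩]
      · rcases hx₁ z hz with rfl | rfl | rfl
        exacts [⟨1, rfl⟩, ⟨3, Sym2.eq_swap⟩, ⟨5, rfl⟩]
      · rcases hx₂ z hz with rfl | rfl | rfl
        exacts [⟨2, rfl⟩, ⟨4, Sym2.eq_swap⟩, ⟨5, Sym2.eq_swap⟩]
      · obtain rfl := hy₀ z hz
        exact ⟨0, Sym2.eq_swap⟩
      · obtain rfl := hy₁ z hz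
        exact ⟨1, Sym2.eq_swap⟩
      · obtain rfl := hy₂ z hz
        exact ⟨2, Sym2.eq_swap⟩
  · obtain ⟨x₀, x₁, x₂, x₃, x₄, x₅, hnd, h01, h12, h23, h34, h45⟩ := h
    have := lambdaMin_mul_le_of_path hnd h01 h12 h23 h34 h45
    -- `θ ≥ 12/7` is incompatible with `θ² = θ + 1`.
    nlinarith

end Main

end HoffmanGL

theorem mainTheorem4 :
    (∀ {V : Type*} [Finite V] (G : SimpleGraph V) (a : V → ℕ),
      (HoffmanGL.generalizedLineGraph G a).Connected →
      HoffmanGL.IsNontriviallyHoffmanColorable (HoffmanGL.generalizedLineGraph G a) →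
      -2 < HoffmanGL.lambdaMin (HoffmanGL.generalizedLineGraph G a) →
      (∀ v, a v = 0) ∧
        Nonempty (HoffmanGL.generalizedLineGraph G a ≃g G.lineGraph)) ∧
    (∀ {W : Type*} [Finite W] (H : SimpleGraph W),
      (H.Connected ∧ HoffmanGL.IsNontriviallyHoffmanColorable H ∧
          HoffmanGL.IsGeneralizedLineGraph H ∧ -2 < HoffmanGL.lambdaMin H) ↔
        Nonempty (H ≃g HoffmanGL.sunGraph)) := by
  classical
  refine ⟨fun {V} _ G a hc hH hmin => ?_, fun {W} _ H => ⟨?_, ?_⟩⟩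
  · have := Fintype.ofFinite V
    have ha := (HoffmanGL.eq_zero_and_isNetLike hc hH hmin).1
    exact ⟨ha, ⟨HoffmanGL.generalizedLineGraphIsoLineGraph G a ha⟩⟩
  · rintro ⟨hc, hH, ⟨n, G, a, ⟨e⟩⟩, hmin⟩
    obtain ⟨ha, hG⟩ := HoffmanGL.eq_zero_and_isNetLike (e.connected_iff.1 hc)
      (HoffmanGL.isNontriviallyHoffmanColorable_of_iso e hH)
      (by rwa [← HoffmanGL.lambdaMin_eq_of_iso e])
    let f : H ≃g G.lineGraph := e.trans (HoffmanGL.generalizedLineGraphIsoLineGraph G a ha)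
    obtain ⟨g⟩ := HoffmanGL.nonempty_lineGraph_iso_sunGraph_of_isNetLike (f.connected_iff.1 hc)
      (HoffmanGL.isNontriviallyHoffmanColorable_of_iso f hH)
      (by rwa [← HoffmanGL.lambdaMin_eq_of_iso f]) hG
    exact ⟨f.trans g⟩
  · rintro ⟨e⟩
    refine ⟨e.connected_iff.2 HoffmanGL.connected_sunGraph,
      HoffmanGL.isNontriviallyHoffmanColorable_of_iso e.symm
        HoffmanGL.isNontriviallyHoffmanColorable_sunGraph, ?_, ?_⟩
    · obtain ⟨n, G, a, ⟨f⟩⟩ := HoffmanGL.isGeneralizedLineGraph_sunGraph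
      exact ⟨n, G, a, ⟨e.trans f⟩⟩
    · rw [HoffmanGL.lambdaMin_eq_of_iso e]
      exact HoffmanGL.neg_two_lt_lambdaMin_sunGraph
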